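/- Let $P(2,\mathbb{Q})=\{h\in \mathrm{GL}(2,\mathbb{Q}) : |\det h|>1\}\cup \mathrm{GL}(2,\mathbb{Z})$, a submonoid of $\mathrm{GL}(2,\mathbb{Q})$. For a monoid $N$, let $\mathrm{Rat}(N)$ be the smallest family of subsets of $N$ that contains all finite subsets and is closed under union, product $K\cdot L$ and Kleene star ($L^*$ is the submonoid generated by $L$). A subset $R\subseteq \mathrm{GL}(2,\mathbb{Q})$ is called flat rational relative to $P(2,\mathbb{Q})$ if it is a finite union of sets of the form $L_0g_1L_1\cdots g_tL_t$ with $t\ge 0$, $L_0,\dots,L_t\in \mathrm{Rat}(P(2,\mathbb{Q}))$ and $g_1,\dots,g_t\in \mathrm{GL}(2,\mathbb{Q})$; such a set is described by a flat rational expression, that is, by the list of its terms, each consisting of the matrices $g_i$ and of rational expressions for the $L_i$ whose letters are matrices in $P(2,\mathbb{Q})$. The membership problem for these sets is decidable: every flat rational subset $R$ of $\mathrm{GL}(2,\mathbb{Q})$ relative to $P(2,\mathbb{Q})$ is described by a flat rational expression, and there is a single algorithm which, given any $g\in \mathrm{GL}(2,\mathbb{Q})$ and any flat rational expression for such a set $R$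 (all matrices being given by their entries as reduced fractions), decides whether $g\in R$. -/

import Mathlib

open scoped Pointwise

namespace FlatRat

/-! ### Rational and flat rational subsets of a monoid -/

/-- `Rat(M)`: the least family of subsets of `M` containing the finite subsets and closed under
union, product and Kleene star (`L*` is the submonoid generated by `L`). -/
inductive IsRational {M : Type*} [Monoid M] : Set M → Prop
  | finite (L : Set M) : L.Finite → IsRational L
  | union (K L : Set M) : IsRational K → IsRational L → IsRational (K ∪ L)
  | mul (K L : Set M) : IsRational K → IsRational L → IsRational (K * L)
  | star (L : Set M) : IsRational L → IsRational (Submonoid.closure L : Set M)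

/-- The set `L₀ g₁ L₁ ⋯ g_t L_t ⊆ M`, where `L₀, …, L_t ⊆ N`; the list holds the pairs
`(g₁, L₁), …, (g_t, L_t)`. -/
def flatProduct {M : Type*} [Monoid M] (N : Submonoid M) (L₀ : Set N) (l : List (M × Set N)) :
    Set M :=
  ((↑) '' L₀ : Set M) * (l.map fun p => ({p.1} : Set M) * ((↑) '' p.2 : Set M)).prod

/-- `L` is a flat rational subset of `M` relative to the submonoid `N`: a finite union of sets
`L₀ g₁ L₁ ⋯ g_t L_t` with all `L_i ∈ Rat(N)` and all `g_i ∈ M`. -/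
def IsFlatRational {M : Type*} [Monoid M] (N : Submonoid M) (L : Set M) : Prop :=
  ∃ F : List (Set N × List (M × Set N)),
    (∀ T ∈ F, IsRational T.1 ∧ ∀ p ∈ T.2, IsRational p.2) ∧
    L = ⋃ T ∈ F, flatProduct N T.1 T.2

/-! ### Expressions for such sets -/

/-- The rational subset of `M` described by a rational expression with letters in `M`. -/
def ratSet {M : Type*} [Monoid M] : RegularExpression M → Set M
  | .zero => ∅
  | .epsilon => {1}
  | .char a => {a}
  | .plus E F => ratSet E ∪ ratSet F
  | .comp E F => ratSet E * ratSet F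
  | .star E => (Submonoid.closure (ratSet E) : Set M)

/-- Expressions for flat rational sets: finite lists (unions) of terms `E₀ g₁ E₁ ⋯ g_t E_t`, with
`g_i` from `A` and `E_i` rational expressions over `B`. -/
abbrev FlatExpr (A B : Type*) : Type _ :=
  List (RegularExpression B × List (A × RegularExpression B))

/-- The subset of `M` described by a flat rational expression. -/
def flatSet {M : Type*} [Monoid M] (N : Submonoid M) (E : FlatExpr M N) : Set M :=
  ⋃ T ∈ E, flatProduct N (ratSet T.1) (T.2.map fun p => (p.1, ratSet p.2))

/-- Letter-by-letter translation of flat rational expressions. -/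
def FlatExpr.mapLetters {A B A' B' : Type*} (f : A → A') (h : B → B') (E : FlatExpr A B) :
    FlatExpr A' B' :=
  List.map (fun T => (T.1.map h, List.map (fun p => (f p.1, p.2.map h)) T.2)) E

/-! ### Numbering rational expressions by natural numbers -/

section Coding

variable {α : Type*} [Denumerable α]

/-- The number of a rational expression over a numbered alphabet. -/
def encodeRegex : RegularExpression α → ℕ
  | .zero => 0
  | .epsilon => 1
  | .char a => 4 * Encodable.encode a + 2
  | .plus E F => 4 * Nat.pair (encodeRegex E) (encodeRegex F) + 3
  | .comp E F => 4 * Nat.pair (encodeRegex E) (encodeRegex F) + 4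
  | .star E => 4 * encodeRegex E + 5

/-- The inverse of `encodeRegex`. -/
def ofNatRegex (α : Type*) [Denumerable α] : ℕ → RegularExpression α
  | 0 => .zero
  | 1 => .epsilon
  | n + 2 =>
    have h₁ : (n / 4).unpair.1 < n + 2 :=
      lt_of_le_of_lt (Nat.unpair_left_le _) (by omega)
    have h₂ : (n / 4).unpair.2 < n + 2 :=
      lt_of_le_of_lt (Nat.unpair_right_le _) (by omega)
    have h₃ : n / 4 < n + 2 := by omega
    if n % 4 = 0 then .char (Denumerable.ofNat α (n / 4))
    else if n % 4 = 1 then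
      .plus (ofNatRegex α (n / 4).unpair.1) (ofNatRegex α (n / 4).unpair.2)
    else if n % 4 = 2 then
      .comp (ofNatRegex α (n / 4).unpair.1) (ofNatRegex α (n / 4).unpair.2)
    else .star (ofNatRegex α (n / 4))

theorem ofNatRegex_encodeRegex (E : RegularExpression α) : ofNatRegex α (encodeRegex E) = E := by
  induction E with
  | zero => rw [encodeRegex, ofNatRegex]
  | epsilon => rw [encodeRegex, ofNatRegex]
  | char a =>
    have h : (4 * Encodable.encode a) / 4 = Encodable.encode a := by omega
    rw [encodeRegex, ofNatRegex, if_pos (by omega), h, Denumerable.ofNat_encode]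
  | plus E F hE hF =>
    have h (k : ℕ) : (4 * k + 1) / 4 = k := by omega
    rw [encodeRegex, ofNatRegex, if_neg (by omega), if_pos (by omega), h, Nat.unpair_pair, hE, hF]
  | comp E F hE hF =>
    have h (k : ℕ) : (4 * k + 2) / 4 = k := by omega
    rw [encodeRegex, ofNatRegex, if_neg (by omega), if_neg (by omega), if_pos (by omega), h,
      Nat.unpair_pair, hE, hF]
  | star E hE =>
    have h (k : ℕ) : (4 * k + 3) / 4 = k := by omega
    rw [encodeRegex, ofNatRegex, if_neg (by omega), if_neg (by omega), if_neg (by omega), h, hE]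

theorem encodeRegex_ofNatRegex (n : ℕ) : encodeRegex (ofNatRegex α n) = n := by
  induction n using Nat.strong_induction_on with
  | _ n ih =>
    match n with
    | 0 => rw [ofNatRegex, encodeRegex]
    | 1 => rw [ofNatRegex, encodeRegex]
    | n + 2 =>
      have h₁ : (n / 4).unpair.1 < n + 2 :=
        lt_of_le_of_lt (Nat.unpair_left_le _) (by omega)
      have h₂ : (n / 4).unpair.2 < n + 2 :=
        lt_of_le_of_lt (Nat.unpair_right_le _) (by omega)
      have h₃ : n / 4 < n + 2 := by omega
      rw [ofNatRegex]
      split_ifs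
      · rw [encodeRegex, Denumerable.encode_ofNat]; omega
      · rw [encodeRegex, ih _ h₁, ih _ h₂, Nat.pair_unpair]; omega
      · rw [encodeRegex, ih _ h₁, ih _ h₂, Nat.pair_unpair]; omega
      · rw [encodeRegex, ih _ h₃]; omega

instance instDenumerableRegex : Denumerable (RegularExpression α) :=
  Denumerable.mk'
    ⟨encodeRegex, ofNatRegex α, ofNatRegex_encodeRegex, encodeRegex_ofNatRegex⟩

end Coding

/-! ### `GL(2,ℚ)` and the submonoid `P(2,ℚ)` -/

/-- `GL(2,ℤ)` as a subgroup of `GL(2,ℚ)`. -/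
def GL2Z : Subgroup (Matrix.GeneralLinearGroup (Fin 2) ℚ) :=
  (Matrix.GeneralLinearGroup.map (n := Fin 2) (Int.castRingHom ℚ)).range

theorem abs_det_of_mem_GL2Z {h : Matrix.GeneralLinearGroup (Fin 2) ℚ} (hh : h ∈ GL2Z) :
    |(h : Matrix (Fin 2) (Fin 2) ℚ).det| = 1 := by
  obtain ⟨a, rfl⟩ := hh
  have h1 : IsUnit (a : Matrix (Fin 2) (Fin 2) ℤ).det :=
    (Matrix.isUnit_iff_isUnit_det _).1 a.isUnit
  have h2 : (Matrix.GeneralLinearGroup.map (n := Fin 2) (Int.castRingHom ℚ) a :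
      Matrix (Fin 2) (Fin 2) ℚ).det = ((a : Matrix (Fin 2) (Fin 2) ℤ).det : ℚ) := by
    simp [Matrix.det_fin_two]
  rw [h2]
  rcases Int.isUnit_iff.1 h1 with h | h <;> simp [h]

/-- `P(2,ℚ) = {h ∈ GL(2,ℚ) : |det h| > 1} ∪ GL(2,ℤ)`. -/
def P2Q : Submonoid (Matrix.GeneralLinearGroup (Fin 2) ℚ) where
  carrier := {h | 1 < |(h : Matrix (Fin 2) (Fin 2) ℚ).det|} ∪ GL2Z
  one_mem' := Or.inr GL2Z.one_mem
  mul_mem' := by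
    rintro a b (ha | ha) (hb | hb)
    · left
      simp only [Set.mem_ofPred_eq, Matrix.GeneralLinearGroup.coe_mul, Matrix.det_mul,
        abs_mul] at *
      nlinarith
    · left
      have := abs_det_of_mem_GL2Z hb
      simp only [Set.mem_ofPred_eq, Matrix.GeneralLinearGroup.coe_mul, Matrix.det_mul,
        abs_mul] at *
      rwa [this, mul_one]
    · left
      have := abs_det_of_mem_GL2Z ha
      simp only [Set.mem_ofPred_eq, Matrix.GeneralLinearGroup.coe_mul, Matrix.det_mul,
        abs_mul] at *
      rwa [this, one_mul]
    · exact Or.inr (GL2Z.mul_mem ha hb)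

/-! ### Finite descriptions of the inputs -/

/-- Finite data describing a rational `2 × 2` matrix: its rows, each entry being given by
numerator and denominator. -/
abbrev MatCode : Type :=
  ((ℤ × ℕ) × (ℤ × ℕ)) × ((ℤ × ℕ) × (ℤ × ℕ))

/-- A rational number as its reduced numerator and positive denominator. -/
def ratCode (q : ℚ) : ℤ × ℕ :=
  (q.num, q.den)

/-- The description of a matrix in `GL(2,ℚ)` by its four entries. -/
def matCode (g : Matrix.GeneralLinearGroup (Fin 2) ℚ) : MatCode :=
  ((ratCode (g.1 0 0), ratCode (g.1 0 1)), (ratCode (g.1 1 0), ratCode (g.1 1 1)))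

/-- The description of a flat rational expression of `GL(2,ℚ)` relative to `P(2,ℚ)`: every matrix
in it is replaced by its description. -/
def flatCode (E : FlatExpr (Matrix.GeneralLinearGroup (Fin 2) ℚ) P2Q) :
    FlatExpr MatCode MatCode :=
  FlatExpr.mapLetters matCode (fun h : P2Q => matCode h) E

end FlatRat

/-!
Letting an element `g` of `GL(2,ℚ)` inside a flat rational term become a letter costs only a scalar:
a common denominator of its entries is multiplied out of it and into the target. So it is enough to
decide whether a target `g` lies in a product of rational sets whose letters are in `P(2,ℚ)` or are
integral, and this is done by two semi-decision procedures run in parallel.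

If `g` lies in the product, unfolding the expressions letter by letter eventually produces `g`.

If it does not, there is a finite certificate. A letter never decreases `|det|`, so only the partial
products with `|det|` at most `|det g|` matter. They have a common denominator, since the letters
which are not integral increase `|det|` by a factor bounded away from `1`. Hence up to left
multiplication by Sanov's free subgroup of finite index in `SL(2,ℤ)` there are finitely many of
them. The certificate is a finite graph on these classes whose edges are labelled by elements of a
ball of the free group and which is closed under those compositions of edges that stay in the ball.
Such local closure suffices because a free group acts on a tree: if a product of elements of a ball
lies in the ball, then it can be evaluated, in a suitable order, without leaving the ball.
-/

namespace FlatRat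

open MatrixGroups

attribute [local fun_prop] Primrec PrimrecPred Primrec.id Primrec.const Primrec.comp Primrec.pair
  Primrec.fst Primrec.snd Primrec.ite PrimrecPred.comp PrimrecPred.and PrimrecPred.or
  PrimrecPred.not

/-! ### Primitive recursion on integers, lists and matrices -/

section PrimrecCalculus

variable {α β γ : Type*} [Primcodable α] [Primcodable β] [Primcodable γ]

@[fun_prop]
theorem primrec_nat_add {f g : α → ℕ} (hf : Primrec f) (hg : Primrec g) :
    Primrec fun a => f a + g a :=
  Primrec.nat_add.comp hf hg

@[fun_prop]
theorem primrec_nat_sub {f g : α → ℕ} (hf : Primrec f) (hg : Primrec g) :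
    Primrec fun a => f a - g a :=
  Primrec.nat_sub.comp hf hg

@[fun_prop]
theorem primrec_nat_mul {f g : α → ℕ} (hf : Primrec f) (hg : Primrec g) :
    Primrec fun a => f a * g a :=
  Primrec.nat_mul.comp hf hg

@[fun_prop]
theorem primrec_nat_div {f g : α → ℕ} (hf : Primrec f) (hg : Primrec g) :
    Primrec fun a => f a / g a :=
  Primrec.nat_div.comp hf hg

@[fun_prop]
theorem primrec_nat_mod {f g : α → ℕ} (hf : Primrec f) (hg : Primrec g) :
    Primrec fun a => f a % g a :=
  Primrec.nat_mod.comp hf hg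

@[fun_prop]
theorem primrecPred_eq {f g : α → β} (hf : Primrec f) (hg : Primrec g) :
    PrimrecPred fun a => f a = g a := by
  classical exact Primrec.eq.comp hf hg

@[fun_prop]
theorem primrecPred_nat_lt {f g : α → ℕ} (hf : Primrec f) (hg : Primrec g) :
    PrimrecPred fun a => f a < g a :=
  Primrec.nat_lt.comp hf hg

@[fun_prop]
theorem primrecPred_imp {p q : α → Prop} (hp : PrimrecPred p) (hq : PrimrecPred q) :
    PrimrecPred fun a => p a → q a :=
  (hp.not.or hq).of_eq fun _ => imp_iff_not_or.symm

@[fun_prop]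
theorem primrecPred_exists_mem {L : α → List β} {P : α → β → Prop} (hL : Primrec L)
    (hP : PrimrecPred fun x : α × β => P x.1 x.2) : PrimrecPred fun a => ∃ b ∈ L a, P a b :=
  have hP' : PrimrecRel fun b a => P a b := hP.comp (Primrec.snd.pair Primrec.fst)
  hP'.exists_mem_list.comp hL Primrec.id

@[fun_prop]
theorem primrecPred_forall_mem {L : α → List β} {P : α → β → Prop} (hL : Primrec L)
    (hP : PrimrecPred fun x : α × β => P x.1 x.2) : PrimrecPred fun a => ∀ b ∈ L a, P a b :=
  have hP' : PrimrecRel fun b a => P a b := hP.comp (Primrec.snd.pair Primrec.fst)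
  hP'.forall_mem_list.comp hL Primrec.id

@[fun_prop]
theorem primrecPred_mem {L : α → List β} {f : α → β} (hL : Primrec L) (hf : Primrec f) :
    PrimrecPred fun a => f a ∈ L a :=
  (by fun_prop : PrimrecPred fun a => ∃ b ∈ L a, b = f a).of_eq fun a => by simp

@[fun_prop]
theorem primrec_list_cons {f : α → β} {L : α → List β} (hf : Primrec f) (hL : Primrec L) :
    Primrec fun a => f a :: L a :=
  Primrec.list_cons.comp hf hL

@[fun_prop]
theorem primrec_list_append {L M : α → List β} (hL : Primrec L) (hM : Primrec M) :
    Primrec fun a => L a ++ M a :=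
  Primrec.list_append.comp hL hM

@[fun_prop]
theorem primrec_list_map {L : α → List β} {f : α → β → γ} (hL : Primrec L)
    (hf : Primrec fun x : α × β => f x.1 x.2) : Primrec fun a => (L a).map (f a) :=
  Primrec.list_map hL hf

@[fun_prop]
theorem primrec_list_flatMap {L : α → List β} {f : α → β → List γ} (hL : Primrec L)
    (hf : Primrec fun x : α × β => f x.1 x.2) : Primrec fun a => (L a).flatMap (f a) :=
  Primrec.list_flatMap hL hf

@[fun_prop]
theorem primrec_int_natCast {f : α → ℕ} (hf : Primrec f) : Primrec fun a => (f a : ℤ) :=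
  have h : Primrec ((↑) : ℕ → ℤ) := Primrec.encode_iff.1 <|
    (by fun_prop : Primrec fun n : ℕ => 2 * n).of_eq fun _ => rfl
  h.comp hf

@[fun_prop]
theorem primrec_int_negSucc {f : α → ℕ} (hf : Primrec f) : Primrec fun a => Int.negSucc (f a) :=
  have h : Primrec Int.negSucc := Primrec.encode_iff.1 <|
    (by fun_prop : Primrec fun n : ℕ => 2 * n + 1).of_eq fun _ => rfl
  h.comp hf

theorem primrec_int_casesOn {f : ℤ → β} (hnat : Primrec fun n : ℕ => f n)
    (hneg : Primrec fun n : ℕ => f (Int.negSucc n)) : Primrec f := by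
  have hsum : Primrec Equiv.intEquivNatSumNat := Primrec.encode_iff.1 <|
    Primrec.encode.of_eq fun z => by cases z <;> rfl
  refine (Primrec.sumCasesOn hsum (hnat.comp Primrec.snd).to₂
    (hneg.comp Primrec.snd).to₂).of_eq fun z => ?_
  cases z <;> rfl

@[fun_prop]
theorem primrec_int_toNat {f : α → ℤ} (hf : Primrec f) : Primrec fun a => (f a).toNat :=
  (primrec_int_casesOn (f := Int.toNat) Primrec.id (Primrec.const 0)).comp hf

@[fun_prop]
theorem primrec_int_neg {f : α → ℤ} (hf : Primrec f) : Primrec fun a => -f a := by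
  refine (primrec_int_casesOn (f := fun z => -z) ?_ ?_).comp hf
  · have h : Primrec fun n : ℕ => if n = 0 then (0 : ℤ) else Int.negSucc (n - 1) := by fun_prop
    refine h.of_eq fun n => ?_
    cases n <;> simp [Int.negSucc_eq]
  · exact (by fun_prop : Primrec fun n : ℕ => ((n + 1 : ℕ) : ℤ)).of_eq fun n => rfl

@[fun_prop]
theorem primrec_int_natAbs {f : α → ℤ} (hf : Primrec f) : Primrec fun a => (f a).natAbs :=
  (by fun_prop : Primrec fun a => (f a).toNat + (-f a).toNat).of_eq fun a => by omega

theorem primrec_int_subNatNat {f g : α → ℕ} (hf : Primrec f) (hg : Primrec g) :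
    Primrec fun a => (f a : ℤ) - g a := by
  have h : Primrec fun a =>
      if f a < g a then Int.negSucc (g a - f a - 1) else ((f a - g a : ℕ) : ℤ) := by fun_prop
  refine h.of_eq fun a => ?_
  split_ifs <;> omega

@[fun_prop]
theorem primrec_int_add {f g : α → ℤ} (hf : Primrec f) (hg : Primrec g) :
    Primrec fun a => f a + g a :=
  (primrec_int_subNatNat (f := fun a => (f a).toNat + (g a).toNat)
    (g := fun a => (-f a).toNat + (-g a).toNat) (by fun_prop) (by fun_prop)).of_eq
      fun a => by omega

@[fun_prop]
theorem primrec_int_sub {f g : α → ℤ} (hf : Primrec f) (hg : Primrec g) :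
    Primrec fun a => f a - g a :=
  (by fun_prop : Primrec fun a => f a + -g a).of_eq fun _ => (sub_eq_add_neg _ _).symm

@[fun_prop]
theorem primrec_int_mul {f g : α → ℤ} (hf : Primrec f) (hg : Primrec g) :
    Primrec fun a => f a * g a := by
  have h : Primrec fun a =>
      (((f a).toNat * (g a).toNat + (-f a).toNat * (-g a).toNat : ℕ) : ℤ) -
        (((f a).toNat * (-g a).toNat + (-f a).toNat * (g a).toNat : ℕ) : ℤ) := by fun_prop
  refine h.of_eq fun a => ?_
  have hf : f a = (f a).toNat - (-f a).toNat := by omega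
  have hg : g a = (g a).toNat - (-g a).toNat := by omega
  conv_rhs => rw [hf, hg]
  push_cast
  ring

@[fun_prop]
theorem primrecPred_int_dvd {f g : α → ℤ} (hf : Primrec f) (hg : Primrec g) :
    PrimrecPred fun a => f a ∣ g a :=
  (by fun_prop : PrimrecPred fun a => (g a).natAbs % (f a).natAbs = 0).of_eq fun a => by
    rw [← Nat.dvd_iff_mod_eq_zero, Int.natAbs_dvd_natAbs]

theorem primrec_sum_fin {n : ℕ} {f : Fin n → α → ℤ} (hf : ∀ i, Primrec (f i)) :
    Primrec fun a => ∑ i, f i a := by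
  induction n with
  | zero => simpa using Primrec.const 0
  | succ n ih =>
    have := ih fun i => hf i.succ
    have := hf 0
    simp only [Fin.sum_univ_succ]
    fun_prop

instance instPrimcodableMatrix {m n : ℕ} : Primcodable (Matrix (Fin m) (Fin n) β) :=
  inferInstanceAs (Primcodable (Fin m → Fin n → β))

theorem primrec_matrix {m n : ℕ} {f : α → Matrix (Fin m) (Fin n) β}
    (hf : ∀ i j, Primrec fun a => f a i j) : Primrec f :=
  Primrec.fin_curry.2 (Primrec.fin_curry₁.2 fun i =>
    Primrec.fin_curry.2 (Primrec.fin_curry₁.2 fun j => hf i j).swap).swap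

theorem primrec_matrix_apply {m n : ℕ} {f : α → Matrix (Fin m) (Fin n) β} (hf : Primrec f)
    (i : Fin m) (j : Fin n) : Primrec fun a => f a i j :=
  Primrec.fin_app.comp (Primrec.fin_app.comp hf (Primrec.const i)) (Primrec.const j)

@[fun_prop]
theorem primrec_matrix_smul {m n : ℕ} {c : α → ℤ} {f : α → Matrix (Fin m) (Fin n) ℤ}
    (hc : Primrec c) (hf : Primrec f) : Primrec fun a => c a • f a :=
  primrec_matrix fun i j => by
    simp only [Matrix.smul_apply, smul_eq_mul]
    exact primrec_int_mul hc (primrec_matrix_apply hf i j)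

@[fun_prop]
theorem primrec_matrix_mul {l m n : ℕ} {f : α → Matrix (Fin l) (Fin m) ℤ}
    {g : α → Matrix (Fin m) (Fin n) ℤ} (hf : Primrec f) (hg : Primrec g) :
    Primrec fun a => f a * g a :=
  primrec_matrix fun i k => by
    simp only [Matrix.mul_apply]
    exact primrec_sum_fin fun j =>
      primrec_int_mul (primrec_matrix_apply hf i j) (primrec_matrix_apply hg j k)

@[fun_prop]
theorem primrec_matrix_det {n : ℕ} {f : α → Matrix (Fin n) (Fin n) ℤ} (hf : Primrec f) :
    Primrec fun a => (f a).det := by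
  induction n with
  | zero => simpa using Primrec.const 1
  | succ n ih =>
    simp only [Matrix.det_succ_row_zero]
    refine primrec_sum_fin fun j => ?_
    have hminor : Primrec fun a => ((f a).submatrix Fin.succ j.succAbove).det :=
      ih (primrec_matrix fun i k => primrec_matrix_apply hf i.succ (j.succAbove k))
    exact primrec_int_mul
      (primrec_int_mul (Primrec.const _) (primrec_matrix_apply hf 0 j)) hminor

@[fun_prop]
theorem primrec_matrix_adjugate {n : ℕ} {f : α → Matrix (Fin n) (Fin n) ℤ} (hf : Primrec f) :
    Primrec fun a => (f a).adjugate :=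
  primrec_matrix fun i j => by
    simp only [Matrix.adjugate_apply]
    refine primrec_matrix_det (primrec_matrix fun k l => ?_)
    by_cases hk : k = j
    · simpa [Matrix.updateRow_apply, hk] using Primrec.const _
    · simpa [Matrix.updateRow_apply, hk] using primrec_matrix_apply hf k l

end PrimrecCalculus

/-- Dovetailing of two semi-decision procedures; a primitive recursive relation stands for the
semi-decidable set of those `a` which have a witness. -/
theorem exists_computable_search {α : Type*} [Primcodable α] {p q : α → ℕ → Prop}
    (hp : PrimrecRel p) (hq : PrimrecRel q) (h : ∀ a, ∃ n, p a n ∨ q a n) :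
    ∃ f : α → Bool, Computable f ∧
      ∀ a, (f a = true → ∃ n, p a n) ∧ (f a = false → ∃ n, q a n) := by
  classical
  let verdict (a : α) (n : ℕ) : Option Bool :=
    if p a n then some true else if q a n then some false else none
  have hverdict : Primrec₂ verdict :=
    Primrec.ite hp (Primrec.const _) (Primrec.ite hq (Primrec.const _) (Primrec.const _))
  have hdom (a : α) : (Nat.rfindOpt (verdict a)).Dom := by
    obtain ⟨n, hn⟩ := h a
    refine Nat.rfindOpt_dom.2 ⟨n, ?_⟩
    by_cases hpn : p a n <;> simp_all [verdict]
  refine ⟨fun a => (Nat.rfindOpt (verdict a)).get (hdom a),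
    (Partrec.rfindOpt hverdict.to_comp).of_eq fun a => (Part.some_get (hdom a)).symm,
    fun a => ?_⟩
  obtain ⟨n, hn⟩ := Nat.rfindOpt_spec (Part.get_mem (hdom a))
  beta_reduce
  generalize (Nat.rfindOpt (verdict a)).get (hdom a) = b at hn ⊢
  by_cases hpn : p a n <;> by_cases hqn : q a n <;> simp_all [verdict] <;> grind

/-! ### The tree geometry of a free group -/

section CommonPrefix

variable {β : Type*} [DecidableEq β]

/-- The length of the longest common prefix of two lists; on reduced words it is the Gromov product
of the corresponding vertices of the Cayley tree. -/
def commonPrefixLength : List β → List β → ℕ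
  | a :: l, b :: m => if a = b then commonPrefixLength l m + 1 else 0
  | _, _ => 0

theorem min_commonPrefixLength_le (l m n : List β) :
    min (commonPrefixLength l m) (commonPrefixLength m n) ≤ commonPrefixLength l n := by
  induction l generalizing m n with
  | nil => simp [commonPrefixLength]
  | cons a l ih =>
    match m, n with
    | [], _ => simp [commonPrefixLength]
    | b :: m, [] => simp [commonPrefixLength]
    | b :: m, c :: n =>
      simp only [commonPrefixLength]
      have := ih m n
      split_ifs <;> simp_all

end CommonPrefix

section FreeGroupNorm

open FreeGroup

variable {α : Type*}

theorem isReduced_invRev_append {a b : α × Bool} {L M : List (α × Bool)}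
    (hL : IsReduced (a :: L)) (hM : IsReduced (b :: M)) (hab : a ≠ b) :
    IsReduced (invRev (a :: L) ++ b :: M) := by
  classical
  have hcons : invRev (a :: L) = invRev L ++ [(a.1, !a.2)] := by simp [invRev]
  have hinv : IsReduced (invRev (a :: L)) := by
    rw [isReduced_iff_reduce_eq, reduce_invRev, hL.reduce_eq]
  have hturn : IsReduced ([(a.1, !a.2)] ++ b :: M) := by
    rw [List.singleton_append, FreeGroup.IsReduced, List.isChain_cons_cons]
    refine ⟨fun hfst => ?_, hM⟩
    contrapose! hab
    exact Prod.ext hfst (by simpa using hab)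
  rw [hcons] at hinv ⊢
  exact hinv.append_overlap hturn (by simp)

variable [DecidableEq α]

theorem norm_mk_of_isReduced {L : List (α × Bool)} (hL : IsReduced L) :
    (mk L).norm = L.length := by
  rw [FreeGroup.norm, toWord_mk, hL.reduce_eq]

theorem norm_inv_mul_mk {L M : List (α × Bool)} (hL : IsReduced L) (hM : IsReduced M) :
    ((mk L)⁻¹ * mk M).norm + 2 * commonPrefixLength L M = L.length + M.length := by
  induction L generalizing M with
  | nil => simp [← one_eq_mk, norm_mk_of_isReduced hM, commonPrefixLength]
  | cons a L ih =>
    match M, hM with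
    | [], _ =>
      rw [← one_eq_mk, mul_one, norm_inv_eq, norm_mk_of_isReduced hL]
      simp [commonPrefixLength]
    | b :: M, hM =>
      by_cases hab : a = b
      · subst hab
        have hcons (l : List (α × Bool)) : mk (a :: l) = mk [a] * mk l := by rw [mul_mk]; rfl
        have hcancel : (mk (a :: L))⁻¹ * mk (a :: M) = (mk L)⁻¹ * mk M := by
          rw [hcons L, hcons M]; group
        have := ih (hL.infix (List.suffix_cons a L).isInfix)
          (hM.infix (List.suffix_cons a M).isInfix)
        rw [hcancel]
        simp only [commonPrefixLength, if_true, List.length_cons]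
        omega
      · rw [inv_mk, mul_mk, norm_mk_of_isReduced (isReduced_invRev_append hL hM hab)]
        simp [commonPrefixLength, hab, invRev_length]

theorem norm_inv_mul (x y : FreeGroup α) :
    (x⁻¹ * y).norm + 2 * commonPrefixLength x.toWord y.toWord = x.norm + y.norm := by
  simpa only [mk_toWord, FreeGroup.norm] using
    norm_inv_mul_mk (isReduced_toWord (x := x)) (isReduced_toWord (x := y))

theorem norm_inv_mul_le_of_norm_le {p z q : FreeGroup α} {N : ℕ} (hp : p.norm ≤ z.norm)
    (hq : q.norm ≤ z.norm) (hpz : (p⁻¹ * z).norm ≤ N) (hzq : (z⁻¹ * q).norm ≤ N) :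
    (p⁻¹ * q).norm ≤ N := by
  have := norm_inv_mul p z
  have := norm_inv_mul z q
  have := norm_inv_mul p q
  have := min_commonPrefixLength_le p.toWord z.toWord q.toWord
  omega

/-- A walk with steps of length at most `N` in which no two consecutive steps can be merged into
one such step never comes back towards the origin once it has moved away from it. -/
theorem norm_le_norm_mul_prod {N : ℕ} (l : List (FreeGroup α)) (x p : FreeGroup α)
    (hl : ∀ y ∈ x :: l, y.norm ≤ N) (hp : p.norm ≤ (p * x).norm)
    (hadj : (x :: l).IsChain fun y z => N < (y * z).norm) :
    (p * x).norm ≤ (p * x * l.prod).norm := by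
  induction l generalizing x p with
  | nil => simp
  | cons y l ih =>
    rw [List.isChain_cons_cons] at hadj
    have haway : (p * x).norm ≤ (p * x * y).norm := by
      by_contra! hback
      have hmerge := norm_inv_mul_le_of_norm_le (N := N) hp hback.le
        (by simpa using hl x (by simp)) (by rw [inv_mul_cancel_left]; exact hl y (by simp))
      rw [show p⁻¹ * (p * x * y) = x * y by group] at hmerge
      exact hadj.1.not_ge hmerge
    have := ih y (p * x) (fun z hz => hl z (List.mem_cons_of_mem _ hz)) haway hadj.2
    rw [List.prod_cons, ← mul_assoc]
    exact haway.trans this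

theorem exists_adjacent_mul_norm_le {N : ℕ} (l : List (FreeGroup α)) (hl : ∀ y ∈ l, y.norm ≤ N)
    (hlen : 2 ≤ l.length) (hprod : l.prod.norm ≤ N) :
    ∃ l₁ x y l₂, l = l₁ ++ x :: y :: l₂ ∧ (x * y).norm ≤ N := by
  by_contra! hcon
  have hadj : l.IsChain fun y z => N < (y * z).norm := by
    rw [List.isChain_iff_forall_rel_of_append_cons_cons]
    exact fun {a b l₁ l₂} h => hcon l₁ a b l₂ h
  match l, hlen, hl, hprod, hadj with
  | x :: y :: l, _, hl, hprod, hadj =>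
    rw [List.isChain_cons_cons] at hadj
    have haway : x.norm ≤ (x * y).norm := (hl x (by simp)).trans hadj.1.le
    have := norm_le_norm_mul_prod l y x (fun z hz => hl z (List.mem_cons_of_mem _ hz)) haway hadj.2
    rw [List.prod_cons, List.prod_cons, ← mul_assoc] at hprod
    exact hadj.1.not_ge (this.trans hprod)

end FreeGroupNorm

section EdgePath

variable {ι G : Type*} {T : ι → G → ι → Prop}

/-- `EdgePath T u l v`: the list `l` labels a path of `T`-edges from `u` to `v`. -/
def EdgePath (T : ι → G → ι → Prop) : ι → List G → ι → Prop
  | u, [], v => u = v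
  | u, x :: l, v => ∃ m, T u x m ∧ EdgePath T m l v

theorem edgePath_append {u v : ι} {l m : List G} :
    EdgePath T u (l ++ m) v ↔ ∃ w, EdgePath T u l w ∧ EdgePath T w m v := by
  induction l generalizing u with
  | nil => simp [EdgePath]
  | cons x l ih => simp only [List.cons_append, EdgePath, ih]; tauto

theorem EdgePath.forall_mem_label {P : G → Prop} (hP : ∀ u x v, T u x v → P x) {u v : ι}
    {l : List G} (hl : EdgePath T u l v) : ∀ x ∈ l, P x := by
  induction l generalizing u with
  | nil => simp
  | cons x l ih =>
    obtain ⟨m, hx, hm⟩ := hl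
    exact List.forall_mem_cons.2 ⟨hP _ _ _ hx, ih hm⟩

/-- By `exists_adjacent_mul_norm_le`, a path whose product lies in the ball can be contracted edge
by edge without leaving the ball. -/
theorem edge_of_edgePath {α : Type*} [DecidableEq α] {T : ι → FreeGroup α → ι → Prop} {N : ℕ}
    (hN : ∀ u x v, T u x v → x.norm ≤ N)
    (hT : ∀ u x v y w, T u x v → T v y w → (x * y).norm ≤ N → T u (x * y) w)
    {u v : ι} (hu : T u 1 u) {l : List (FreeGroup α)} (hl : EdgePath T u l v)
    (hprod : l.prod.norm ≤ N) : T u l.prod v := by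
  induction hn : l.length using Nat.strong_induction_on generalizing l with
  | _ n ih =>
    match l, hl with
    | [], hl => cases hl; simpa using hu
    | [x], ⟨m, hx, hm⟩ => cases hm; simpa using hx
    | x :: y :: l, hl =>
      obtain ⟨l₁, a, b, l₂, heq, hab⟩ :=
        exists_adjacent_mul_norm_le _ (hl.forall_mem_label hN) (by simp) hprod
      rw [heq] at hl hprod hn ⊢
      obtain ⟨w, hl₁, m, ha, m', hb, hl₂⟩ := edgePath_append.1 hl
      have hmerge : (l₁ ++ (a * b) :: l₂).prod = (l₁ ++ a :: b :: l₂).prod := by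
        simp [mul_assoc]
      rw [← hmerge] at hprod ⊢
      exact ih (l₁ ++ (a * b) :: l₂).length (by simp [← hn])
        (edgePath_append.2 ⟨w, hl₁, m', hT _ _ _ _ _ ha hb hab, hl₂⟩) hprod rfl

end EdgePath

/-! ### The Sanov subgroup of `SL(2,ℤ)` -/

section Sanov

open Matrix
open Matrix.SpecialLinearGroup (transvection)

theorem injective_lift_of_zpow_ping_pong {ι G α : Type*} [Nontrivial ι] [Group G] [MulAction G α]
    {a : ι → G} {X : ι → Set α} (hne : ∀ i, (X i).Nonempty)
    (hdisj : Pairwise (Function.onFun Disjoint X))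
    (hX : ∀ i j, i ≠ j → ∀ n : ℤ, n ≠ 0 → a i ^ n • X j ⊆ X i) :
    Function.Injective (FreeGroup.lift a) := by
  have hlift : FreeGroup.lift a =
      (Monoid.CoprodI.lift fun i => FreeGroup.lift fun _ : Unit => a i).comp
        freeGroupEquivCoprodI.toMonoidHom := by
    ext i; simp
  rw [hlift, MonoidHom.coe_comp]
  refine Function.Injective.comp ?_ freeGroupEquivCoprodI.injective
  refine Monoid.CoprodI.lift_injective_of_ping_pong _ ?_ X hne hdisj fun i j hij => ?_
  · obtain ⟨i⟩ : Nonempty ι := inferInstance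
    exact Or.inr ⟨i, by simp⟩
  · refine FreeGroup.freeGroupUnitEquivInt.forall_congr_left.2 fun n hn => ?_
    have hzero : n ≠ 0 := fun h => hn (by simp [h, FreeGroup.freeGroupUnitEquivInt])
    simpa [FreeGroup.freeGroupUnitEquivInt] using hX i j hij n hzero

theorem transvection_zpow {ι R : Type*} [Fintype ι] [DecidableEq ι] [CommRing R] {i j : ι}
    (hij : i ≠ j) (c : R) (n : ℤ) : transvection hij c ^ n = transvection hij (n * c) := by
  have hadd (b d : R) : transvection hij b * transvection hij d = transvection hij (b + d) :=
    Subtype.ext (transvection_mul_transvection_same i j hij b d)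
  have hneg : (transvection hij c)⁻¹ = transvection hij (-c) :=
    inv_eq_of_mul_eq_one_left (by rw [hadd]; simp [SpecialLinearGroup.transvection_coeff_zero])
  induction n using Int.induction_on with
  | zero => simp [SpecialLinearGroup.transvection_coeff_zero]
  | succ n ih => rw [_root_.zpow_add_one, ih, hadd]; congr 1; push_cast; ring
  | pred n ih => rw [_root_.zpow_sub_one, ih, hneg, hadd]; congr 1; push_cast; ring

theorem ne_add_one (i : Fin 2) : i ≠ i + 1 := by
  decide +revert

theorem eq_add_one_of_ne {i j : Fin 2} (hij : i ≠ j) : j = i + 1 := by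
  decide +revert

theorem add_one_add_one (i : Fin 2) : i + 1 + 1 = i := by
  decide +revert

/-- The generators `(1 2; 0 1)` and `(1 0; 2 1)` of the Sanov subgroup. -/
def sanovGen (i : Fin 2) : SL(2, ℤ) :=
  transvection (ne_add_one i) 2

/-- The representation of the free group of rank two by the Sanov subgroup. -/
def sanov : FreeGroup (Fin 2) →* SL(2, ℤ) :=
  FreeGroup.lift sanovGen

theorem sanovGen_zpow_mul_apply_same (i : Fin 2) (n : ℤ) (m : SL(2, ℤ)) (k : Fin 2) :
    (sanovGen i ^ n * m) i k = m i k + n * 2 * m (i + 1) k := by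
  rw [sanovGen, transvection_zpow]
  exact transvection_mul_apply_same i (i + 1) k _ m.1

theorem sanovGen_zpow_mul_apply_succ (i : Fin 2) (n : ℤ) (m : SL(2, ℤ)) (k : Fin 2) :
    (sanovGen i ^ n * m) (i + 1) k = m (i + 1) k := by
  rw [sanovGen, transvection_zpow]
  exact transvection_mul_apply_of_ne i (i + 1) (i + 1) k (ne_add_one i).symm _ m.1

theorem sanov_injective : Function.Injective sanov := by
  let X (i : Fin 2) : Set SL(2, ℤ) := {m | |m (i + 1) 0| < |m i 0|}
  refine injective_lift_of_zpow_ping_pong (X := X) (fun i => ?_) (fun i j hij => ?_)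
    fun i j hij n hn => ?_
  · fin_cases i
    exacts [⟨1, by simp [X]⟩,
      ⟨sanovGen 1, by simp [X, sanovGen, SpecialLinearGroup.transvection_coe]⟩]
  · obtain rfl := eq_add_one_of_ne hij
    refine Set.disjoint_left.2 fun m hi hj => ?_
    simp only [X, Set.mem_ofPred_eq, add_one_add_one] at hi hj
    exact hi.asymm hj
  · rintro _ ⟨m, hm, rfl⟩
    obtain rfl := eq_add_one_of_ne hij
    simp only [X, Set.mem_ofPred_eq, add_one_add_one, smul_eq_mul, sanovGen_zpow_mul_apply_same,
      sanovGen_zpow_mul_apply_succ] at hm ⊢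
    have hn : 1 ≤ |n| := Int.one_le_abs hn
    have := abs_sub_abs_le_abs_add (n * 2 * m (i + 1) 0) (m i 0)
    rw [abs_mul, abs_mul, abs_two, add_comm (_ * _)] at this
    nlinarith [abs_nonneg (m i 0), abs_nonneg (m (i + 1) 0)]

/-- The congruences which define the Sanov subgroup of `SL(2,ℤ)`. -/
def SanovCongr (m : SL(2, ℤ)) : Prop :=
  m 0 0 % 4 = 1 ∧ m 0 1 % 2 = 0 ∧ m 1 0 % 2 = 0 ∧ m 1 1 % 2 = 1

theorem SanovCongr.zpow_mul {m : SL(2, ℤ)} (hm : SanovCongr m) (i : Fin 2) (n : ℤ) :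
    SanovCongr (sanovGen i ^ n * m) := by
  obtain ⟨h₁, h₂, h₃, h₄⟩ := hm
  fin_cases i
  · have hrow₀ (k) : (sanovGen 0 ^ n * m) 0 k = m 0 k + n * 2 * m 1 k :=
      sanovGen_zpow_mul_apply_same 0 n m k
    have hrow₁ (k) : (sanovGen 0 ^ n * m) 1 k = m 1 k := sanovGen_zpow_mul_apply_succ 0 n m k
    simp only [SanovCongr, Fin.zero_eta, hrow₀, hrow₁]
    obtain ⟨c, hc⟩ := Int.dvd_of_emod_eq_zero h₃
    refine ⟨?_, ?_, h₃, h₄⟩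
    · rw [hc, show n * 2 * (2 * c) = 4 * (n * c) by ring]; omega
    · rw [mul_right_comm]; omega
  · have hrow₀ (k) : (sanovGen 1 ^ n * m) 0 k = m 0 k := sanovGen_zpow_mul_apply_succ 1 n m k
    have hrow₁ (k) : (sanovGen 1 ^ n * m) 1 k = m 1 k + n * 2 * m 0 k :=
      sanovGen_zpow_mul_apply_same 1 n m k
    simp only [SanovCongr, Fin.mk_one, hrow₀, hrow₁]
    exact ⟨h₁, h₂, by rw [mul_right_comm]; omega, by rw [mul_right_comm]; omega⟩

theorem sanovCongr_sanov (w : FreeGroup (Fin 2)) : SanovCongr (sanov w) := by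
  suffices h : ∀ m, SanovCongr m → SanovCongr (sanov w * m) by
    simpa using h 1 (by simp [SanovCongr])
  induction w using FreeGroup.induction_on with
  | C1 => simp
  | of i => exact fun m hm => by simpa [sanov] using hm.zpow_mul i 1
  | inv_of i _ => exact fun m hm => by simpa [sanov] using hm.zpow_mul i (-1)
  | mul x y hx hy => exact fun m hm => by rw [map_mul, mul_assoc]; exact hx _ (hy _ hm)

theorem SanovCongr.eq_sanovGen_zpow {m : SL(2, ℤ)} (hm : SanovCongr m) (hc : m 1 0 = 0) :
    m = sanovGen 0 ^ (m 0 1 / 2) := by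
  obtain ⟨ha, hb, -, -⟩ := hm
  have hdet : m 0 0 * m 1 1 = 1 := by
    simpa only [det_fin_two, hc, mul_zero, sub_zero] using m.2
  have hdiag : m 0 0 = 1 ∧ m 1 1 = 1 := by
    rcases Int.eq_one_or_neg_one_of_mul_eq_one' hdet with h | h
    · exact h
    · omega
  have hb' : m 0 1 / 2 * 2 = m 0 1 := by omega
  rw [sanovGen, transvection_zpow]
  ext i j
  fin_cases i <;> fin_cases j <;> simp [SpecialLinearGroup.transvection_coe, hdiag, hc, hb']

theorem exists_natAbs_add_mul_lt {x y : ℤ} (hy : y ≠ 0) (hyx : y.natAbs < x.natAbs) :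
    ∃ n, (x + n * 2 * y).natAbs < x.natAbs := by
  rcases lt_or_ge 0 (x * y) with hxy | hxy
  · refine ⟨-1, ?_⟩
    rcases pos_and_pos_or_neg_and_neg_of_mul_pos hxy with h | h <;> omega
  · refine ⟨1, ?_⟩
    rcases mul_nonpos_iff.1 hxy with h | h <;> omega

theorem exists_sanov_eq {m : SL(2, ℤ)} (hm : SanovCongr m) : ∃ w, sanov w = m := by
  induction hn : (m 0 0).natAbs + (m 1 0).natAbs using Nat.strong_induction_on
    generalizing m with
  | _ n ih =>
    by_cases hc : m 1 0 = 0
    · exact ⟨FreeGroup.of 0 ^ (m 0 1 / 2), by simp [sanov, ← hm.eq_sanovGen_zpow hc]⟩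
    · obtain ⟨i, hi, hlt⟩ : ∃ i : Fin 2, m (i + 1) 0 ≠ 0 ∧
          (m (i + 1) 0).natAbs < (m i 0).natAbs := by
        obtain ⟨ha, -, hc', -⟩ := id hm
        rcases lt_trichotomy (m 0 0).natAbs (m 1 0).natAbs with h | h | h
        · exact ⟨1, show m 0 0 ≠ 0 by omega, h⟩
        · omega
        · exact ⟨0, hc, h⟩
      obtain ⟨k, hk⟩ := exists_natAbs_add_mul_lt hi hlt
      rw [← sanovGen_zpow_mul_apply_same] at hk
      have hsucc := sanovGen_zpow_mul_apply_succ i k m 0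
      have hsum : ((sanovGen i ^ k * m) 0 0).natAbs + ((sanovGen i ^ k * m) 1 0).natAbs < n := by
        generalize sanovGen i ^ k * m = m' at hk hsucc ⊢
        subst hn
        fin_cases i
        · have : m' 1 0 = m 1 0 := hsucc
          exact Nat.add_lt_add_of_lt_of_le hk (by rw [this])
        · have : m' 0 0 = m 0 0 := hsucc
          exact Nat.add_lt_add_of_le_of_lt (by rw [this]) hk
      obtain ⟨w, hw⟩ := ih _ hsum (hm.zpow_mul i k) rfl
      exact ⟨(FreeGroup.of i ^ k)⁻¹ * w, by rw [map_mul, hw]; simp [sanov]⟩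

end Sanov

/-! ### Unfolding products of rational expressions -/

section Unfolding

variable {α M : Type*} [Monoid M] (φ : α → M)

/-- A list of rational expressions, standing for their product. -/
abbrev Stack (α : Type*) : Type _ :=
  List (RegularExpression α)

/-- The set described by a product of rational expressions, the letter `a` standing for `φ a`. -/
def stackSet (s : Stack α) : Set M :=
  (s.map fun E => ratSet (E.map φ)).prod

/-- The possible first moves in spelling out an element of a product of rational expressions: the
factor which is split off on the left, and the product which remains. -/
def next : Stack α → List (M × Stack α)
  | [] => []
  | .zero :: _ => []
  | .epsilon :: r => [(1, r)]
  | .char a :: r => [(φ a, r)]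
  | .plus E F :: r => [(1, E :: r), (1, F :: r)]
  | .comp E F :: r => [(1, E :: F :: r)]
  | .star E :: r => [(1, r), (1, E :: .star E :: r)]

/-- `Unfolds φ s k t`: some sequence of moves leads from `s` to `t` and splits off factors with
product `k`. -/
inductive Unfolds (s : Stack α) : M → Stack α → Prop
  | refl : Unfolds s 1 s
  | step {k : M} {t : Stack α} (p : M × Stack α) :
      Unfolds s k t → p ∈ next φ t → Unfolds s (k * p.1) p.2

variable {φ} {s t r : Stack α} {k l : M}

theorem Unfolds.trans (h : Unfolds φ s k t) (h' : Unfolds φ t l r) : Unfolds φ s (k * l) r := by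
  induction h' with
  | refl => rwa [mul_one]
  | step p _ hp ih => rw [← mul_assoc]; exact ih.step p hp

theorem Unfolds.head (p : M × Stack α) (hp : p ∈ next φ s) (h : Unfolds φ p.2 k t) :
    Unfolds φ s (p.1 * k) t :=
  .trans (one_mul p.1 ▸ Unfolds.refl.step p hp) h

theorem stackSet_cons (E : RegularExpression α) (s : Stack α) :
    stackSet φ (E :: s) = ratSet (E.map φ) * stackSet φ s :=
  List.prod_cons

theorem mul_mem_stackSet_of_mem_next {p : M × Stack α} (hp : p ∈ next φ s)
    (hk : k ∈ stackSet φ p.2) : p.1 * k ∈ stackSet φ s := by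
  match s with
  | [] | .zero :: _ => simp [next] at hp
  | .epsilon :: _ | .char _ :: _ =>
    obtain rfl := List.mem_singleton.1 hp
    exact Set.mul_mem_mul rfl hk
  | .plus E F :: r =>
    rcases List.mem_pair.1 hp with rfl | rfl <;> rw [stackSet_cons] at hk ⊢ <;> rw [one_mul]
    · exact Set.mul_subset_mul_right Set.subset_union_left hk
    · exact Set.mul_subset_mul_right Set.subset_union_right hk
  | .comp E F :: r =>
    obtain rfl := List.mem_singleton.1 hp
    rw [stackSet_cons, stackSet_cons, ← mul_assoc] at hk
    rwa [one_mul]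
  | .star E :: r =>
    rcases List.mem_pair.1 hp with rfl | rfl
    · exact Set.mul_mem_mul (Submonoid.one_mem _) hk
    · rw [stackSet_cons, stackSet_cons, ← mul_assoc] at hk
      rw [one_mul]
      refine Set.mul_subset_mul_right ?_ hk
      rintro _ ⟨a, ha, b, hb, rfl⟩
      exact Submonoid.mul_mem _ (Submonoid.subset_closure ha) hb

theorem Unfolds.mul_mem_stackSet (h : Unfolds φ s k t) (hl : l ∈ stackSet φ t) :
    k * l ∈ stackSet φ s := by
  induction h generalizing l with
  | refl => rwa [one_mul]
  | step p _ hp ih =>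
    rw [mul_assoc]
    exact ih (mul_mem_stackSet_of_mem_next hp hl)

theorem unfolds_of_mem_ratSet (E : RegularExpression α) (hk : k ∈ ratSet (E.map φ))
    (r : Stack α) : Unfolds φ (E :: r) k r := by
  induction E generalizing k r with
  | zero => exact hk.elim
  | epsilon =>
    obtain rfl := hk
    simpa using Unfolds.head (1, r) (s := .epsilon :: r) (by simp [next]) .refl
  | char a =>
    obtain rfl := hk
    simpa using Unfolds.head (φ a, r) (s := .char a :: r) (by simp [next]) .refl
  | plus E F hE hF =>
    rcases hk with hk | hk
    · simpa using Unfolds.head (1, E :: r) (s := .plus E F :: r) (by simp [next]) (hE hk r)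
    · simpa using Unfolds.head (1, F :: r) (s := .plus E F :: r) (by simp [next]) (hF hk r)
  | comp E F hE hF =>
    obtain ⟨x, hx, y, hy, rfl⟩ := hk
    simpa using Unfolds.head (1, E :: F :: r) (s := .comp E F :: r) (by simp [next])
      ((hE hx (F :: r)).trans (hF hy r))
  | star E hE =>
    have loop : Unfolds φ (.star E :: r) k (.star E :: r) := by
      refine Submonoid.closure_induction (fun x hx => ?_) .refl (fun x y _ _ => .trans) hk
      simpa using Unfolds.head (1, E :: .star E :: r) (s := .star E :: r) (by simp [next])
        (hE hx (.star E :: r))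
    simpa using loop.step (1, r) (by simp [next])

theorem mem_stackSet_iff : k ∈ stackSet φ s ↔ Unfolds φ s k [] := by
  refine ⟨fun hk => ?_, fun h => by simpa using h.mul_mem_stackSet (Set.mem_one.2 rfl)⟩
  induction s generalizing k with
  | nil => exact Set.mem_one.1 hk ▸ .refl
  | cons E s ih =>
    rw [stackSet_cons] at hk
    obtain ⟨x, hx, y, hy, rfl⟩ := hk
    exact (unfolds_of_mem_ratSet E hx s).trans (ih hy)

/-- The products of the form `⋯ :: r` which can arise from `E :: r` before `E` is used up. -/
def headUnfoldings : RegularExpression α → Stack α → List (Stack α)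
  | .zero, r => [.zero :: r]
  | .epsilon, r => [.epsilon :: r]
  | .char a, r => [.char a :: r]
  | .plus E F, r => (.plus E F :: r) :: (headUnfoldings E r ++ headUnfoldings F r)
  | .comp E F, r => (.comp E F :: r) :: (headUnfoldings E (F :: r) ++ headUnfoldings F r)
  | .star E, r => (.star E :: r) :: headUnfoldings E (.star E :: r)

theorem cons_mem_headUnfoldings (E : RegularExpression α) (r : Stack α) :
    E :: r ∈ headUnfoldings E r := by
  cases E <;> simp [headUnfoldings]

theorem mem_headUnfoldings_of_mem_next (E : RegularExpression α)
    (ht : t ∈ headUnfoldings E r) {p : M × Stack α} (hp : p ∈ next φ t) :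
    p.2 ∈ headUnfoldings E r ∨ p.2 = r := by
  induction E generalizing r with
  | zero | epsilon | char =>
    obtain rfl := List.mem_singleton.1 ht
    simp_all [next]
  | plus E F hE hF | comp E F hE hF =>
    simp only [headUnfoldings, List.mem_cons, List.mem_append] at ht ⊢
    have := cons_mem_headUnfoldings E
    have := cons_mem_headUnfoldings F
    grind [next]
  | star E hE =>
    simp only [headUnfoldings, List.mem_cons] at ht ⊢
    have := cons_mem_headUnfoldings E
    grind [next]

theorem finite_setOf_unfolds (φ : α → M) (s : Stack α) : {t | ∃ k, Unfolds φ s k t}.Finite := by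
  obtain ⟨S, hs, hS⟩ : ∃ S : List (Stack α), s ∈ S ∧ ∀ t ∈ S, ∀ p ∈ next φ t, p.2 ∈ S := by
    induction s with
    | nil => exact ⟨[[]], by simp [next]⟩
    | cons E s ih =>
      obtain ⟨S, hs, hS⟩ := ih
      refine ⟨headUnfoldings E s ++ S,
        List.mem_append_left _ (cons_mem_headUnfoldings E s), fun t ht p hp => ?_⟩
      rw [List.mem_append] at ht ⊢
      rcases ht with ht | ht
      · rcases mem_headUnfoldings_of_mem_next E ht hp with h | h
        exacts [.inl h, .inr (h ▸ hs)]
      · exact .inr (hS t ht p hp)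
  refine S.finite_toSet.subset ?_
  rintro t ⟨k, h⟩
  induction h with
  | refl => exact hs
  | step p _ hp ih => exact hS _ ih p hp

variable (φ)

/-- The pairs `(t, k)` such that `n` moves lead from `s` to `t` and split off `k`. -/
def reachAt (s : Stack α) : ℕ → List (Stack α × M)
  | 0 => [(s, 1)]
  | n + 1 => (reachAt s n).flatMap fun u => (next φ u.1).map fun p => (p.2, u.2 * p.1)

variable {φ}

theorem unfolds_iff_exists_mem_reachAt : Unfolds φ s k t ↔ ∃ n, (t, k) ∈ reachAt φ s n := by
  constructor
  · intro h
    induction h with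
    | refl => exact ⟨0, List.mem_singleton.2 rfl⟩
    | step p _ hp ih =>
      obtain ⟨n, hn⟩ := ih
      exact ⟨n + 1, List.mem_flatMap.2 ⟨_, hn, List.mem_map.2 ⟨p, hp, rfl⟩⟩⟩
  · rintro ⟨n, hn⟩
    induction n generalizing t k with
    | zero =>
      cases List.mem_singleton.1 hn
      exact .refl
    | succ n ih =>
      obtain ⟨u, hu, hn⟩ := List.mem_flatMap.1 hn
      obtain ⟨p, hp, he⟩ := List.mem_map.1 hn
      cases he
      exact (ih hu).step p hp

end Unfolding

section PrimrecUnfolding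

variable {α : Type*} [Denumerable α]

theorem primrec_regex_casesOn {γ β : Type*} [Primcodable γ] [Primcodable β]
    {f : γ → RegularExpression α → β}
    (hzero : Primrec fun c => f c .zero) (hepsilon : Primrec fun c => f c .epsilon)
    (hchar : Primrec fun p : γ × α => f p.1 (.char p.2))
    (hplus : Primrec fun p : γ × RegularExpression α × RegularExpression α =>
      f p.1 (.plus p.2.1 p.2.2))
    (hcomp : Primrec fun p : γ × RegularExpression α × RegularExpression α =>
      f p.1 (.comp p.2.1 p.2.2))
    (hstar : Primrec fun p : γ × RegularExpression α => f p.1 (.star p.2)) :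
    Primrec fun p : γ × RegularExpression α => f p.1 p.2 := by
  let m (p : γ × RegularExpression α) : ℕ := Encodable.encode p.2 - 2
  have hn : Primrec fun p : γ × RegularExpression α => Encodable.encode p.2 :=
    Primrec.encode.comp Primrec.snd
  have hm : Primrec m := primrec_nat_sub hn (Primrec.const 2)
  have hq : Primrec fun p => m p / 4 := by fun_prop
  have hsub {σ : Type _} [Denumerable σ] {g : ℕ → ℕ} (hg : Primrec g) :
      Primrec fun p => Denumerable.ofNat σ (g (m p / 4)) :=
    (Primrec.ofNat σ).comp (hg.comp hq)
  have hleft := hsub (σ := RegularExpression α) (Primrec.fst.comp Primrec.unpair)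
  have hright := hsub (σ := RegularExpression α) (Primrec.snd.comp Primrec.unpair)
  refine (Primrec.ite (primrecPred_eq hn (Primrec.const 0)) (hzero.comp Primrec.fst) <|
    Primrec.ite (primrecPred_eq hn (Primrec.const 1)) (hepsilon.comp Primrec.fst) <|
    Primrec.ite (c := fun p => m p % 4 = 0) (by fun_prop)
      (hchar.comp (Primrec.fst.pair (hsub Primrec.id))) <|
    Primrec.ite (c := fun p => m p % 4 = 1) (by fun_prop)
      (hplus.comp (Primrec.fst.pair (hleft.pair hright))) <|
    Primrec.ite (c := fun p => m p % 4 = 2) (by fun_prop)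
      (hcomp.comp (Primrec.fst.pair (hleft.pair hright)))
      (hstar.comp (Primrec.fst.pair (hsub Primrec.id)))).of_eq fun p => ?_
  obtain ⟨c, n, rfl⟩ : ∃ c n, p = (c, Denumerable.ofNat (RegularExpression α) n) :=
    ⟨p.1, Encodable.encode p.2, by simp⟩
  have hofNat (n : ℕ) : Denumerable.ofNat (RegularExpression α) n = ofNatRegex α n := rfl
  have hencode (n : ℕ) : Encodable.encode (ofNatRegex α n) = n := encodeRegex_ofNatRegex n
  simp only [m, hofNat, hencode]
  match n with
  | 0 | 1 => rw [ofNatRegex]; rfl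
  | n + 2 =>
    rw [ofNatRegex]
    split_ifs <;> first | rfl | contradiction | omega

@[fun_prop]
theorem primrec_char {γ : Type*} [Primcodable γ] {f : γ → α} (hf : Primrec f) :
    Primrec fun c => RegularExpression.char (f c) :=
  have hcode := Primrec.encode.comp hf
  Primrec.encode_iff.1 (by fun_prop : Primrec fun c => 4 * Encodable.encode (f c) + 2)

@[fun_prop]
theorem primrec_star {γ : Type*} [Primcodable γ] {f : γ → RegularExpression α}
    (hf : Primrec f) : Primrec fun c => RegularExpression.star (f c) :=
  have hcode := Primrec.encode.comp hf
  Primrec.encode_iff.1 (by fun_prop : Primrec fun c => 4 * Encodable.encode (f c) + 5)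

@[fun_prop]
theorem primrec_next {γ M : Type*} [Primcodable γ] [Monoid M] [Primcodable M] {φ : α → M}
    (hφ : Primrec φ) {f : γ → Stack α} (hf : Primrec f) : Primrec fun c => next φ (f c) := by
  suffices Primrec (next φ) from this.comp hf
  have h : Primrec fun p : Stack α × RegularExpression α => next φ (p.2 :: p.1) := by
    apply primrec_regex_casesOn (f := fun r E => next φ (E :: r)) <;>
      simp only [next] <;> fun_prop
  refine (Primrec.list_casesOn (h := fun _ p => next φ (p.1 :: p.2)) Primrec.id
    (Primrec.const []) (h.comp (Primrec.pair (Primrec.snd.comp Primrec.snd)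
      (Primrec.fst.comp Primrec.snd)))).of_eq fun s => ?_
  cases s <;> rfl

@[fun_prop]
theorem primrec_reachAt {γ M : Type*} [Primcodable γ] [Monoid M] [Primcodable M] {φ : α → M}
    (hφ : Primrec φ) (hM : Primrec fun p : M × M => p.1 * p.2) {f : γ → Stack α} {n : γ → ℕ}
    (hf : Primrec f) (hn : Primrec n) : Primrec fun c => reachAt φ (f c) (n c) := by
  have h : Primrec₂ fun (_ : Stack α) (p : ℕ × List (Stack α × M)) =>
      p.2.flatMap fun u => (next φ u.1).map fun t => (t.2, u.2 * t.1) :=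
    primrec_list_flatMap (by fun_prop) (primrec_list_map (by fun_prop)
      (Primrec.pair (by fun_prop)
      (Primrec₂.comp (f := fun k l : M => k * l) hM (by fun_prop) (by fun_prop))))
  have h0 : Primrec fun s : Stack α => [(s, (1 : M))] := by fun_prop
  refine ((Primrec.nat_rec h0 h).of_eq fun s n => ?_).comp hf hn
  induction n with
  | zero => rfl
  | succ n ih => simp only [reachAt, ← ih]

end PrimrecUnfolding

/-! ### Matrix fractions -/

/-- Integer matrices, as numerators of matrix fractions. -/
abbrev IntMat : Type := Matrix (Fin 2) (Fin 2) ℤ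

/-- Matrix fractions: `(A, d)` stands for the rational matrix `A / d`. They form a monoid on which
the operations are primitive recursive; fractions need not be reduced. -/
abbrev FracMat : Type := IntMat × ℕ

/-- The inclusion of integer matrices into rational matrices. -/
def ratMat : IntMat →+* Matrix (Fin 2) (Fin 2) ℚ :=
  (Int.castRingHom ℚ).mapMatrix

/-- The rational matrix described by a matrix fraction. -/
def fracVal : FracMat →* Matrix (Fin 2) (Fin 2) ℚ where
  toFun k := (k.2 : ℚ)⁻¹ • ratMat k.1
  map_one' := by simp
  map_mul' k l := by simp [mul_comm, smul_smul]

/-- Equality of matrix fractions with nonzero denominators. -/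
def FracEq (k l : FracMat) : Prop :=
  (l.2 : ℤ) • k.1 = (k.2 : ℤ) • l.1

/-- The comparison `|det g| < |det k|` of matrix fractions with nonzero denominators. -/
def DetExceeds (k g : FracMat) : Prop :=
  g.1.det.natAbs * (k.2 * k.2) < k.1.det.natAbs * (g.2 * g.2)

/-- A sufficient condition for a matrix fraction to describe an element of `P(2,ℚ)`. Elements of
`GL(2,ℤ)` are required to have denominator `1`. -/
def Admissible (k : FracMat) : Prop :=
  k.2 ≠ 0 ∧ (k.2 * k.2 < k.1.det.natAbs ∨ k.2 = 1 ∧ k.1.det.natAbs = 1)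

/-- The condition that `g k⁻¹`, which is the quotient of the integer matrix `A` by `δ`, belongs to
Sanov's subgroup. -/
def SanovEquiv (k g : FracMat) : Prop :=
  let δ : ℤ := g.2 * k.1.det
  let A : IntMat := (k.2 : ℤ) • (g.1 * k.1.adjugate)
  A.det = δ * δ ∧ 4 * δ ∣ A 0 0 - δ ∧ 2 * δ ∣ A 0 1 ∧ 2 * δ ∣ A 1 0 ∧ 2 * δ ∣ A 1 1 - δ

@[fun_prop]
theorem primrec_fracMat_mul {α : Type*} [Primcodable α] {f g : α → FracMat} (hf : Primrec f)
    (hg : Primrec g) : Primrec fun a => f a * g a :=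
  Primrec.pair (by fun_prop : Primrec fun a => (f a).1 * (g a).1)
    (by fun_prop : Primrec fun a => (f a).2 * (g a).2)

@[fun_prop]
theorem primrecPred_fracEq {α : Type*} [Primcodable α] {f g : α → FracMat} (hf : Primrec f)
    (hg : Primrec g) : PrimrecPred fun a => FracEq (f a) (g a) := by
  unfold FracEq
  fun_prop

@[fun_prop]
theorem primrecPred_detExceeds {α : Type*} [Primcodable α] {f g : α → FracMat} (hf : Primrec f)
    (hg : Primrec g) : PrimrecPred fun a => DetExceeds (f a) (g a) := by
  unfold DetExceeds
  fun_prop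

@[fun_prop]
theorem primrecPred_admissible {α : Type*} [Primcodable α] {f : α → FracMat} (hf : Primrec f) :
    PrimrecPred fun a => Admissible (f a) := by
  unfold Admissible
  fun_prop

@[fun_prop]
theorem primrecPred_sanovEquiv {α : Type*} [Primcodable α] {f g : α → FracMat} (hf : Primrec f)
    (hg : Primrec g) : PrimrecPred fun a => SanovEquiv (f a) (g a) := by
  have hA : Primrec fun a => ((f a).2 : ℤ) • ((g a).1 * (f a).1.adjugate) := by fun_prop
  have hAij := primrec_matrix_apply hA
  simp only [SanovEquiv]
  fun_prop

section Values

variable {k l g : FracMat}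

theorem ratMat_injective : Function.Injective ratMat :=
  Matrix.map_injective Int.cast_injective

theorem ratMat_smul (n : ℤ) (x : IntMat) : ratMat (n • x) = (n : ℚ) • ratMat x := by
  rw [map_zsmul, Int.cast_smul_eq_zsmul]

theorem det_ratMat (x : IntMat) : (ratMat x).det = x.det :=
  (RingHom.map_det (Int.castRingHom ℚ) x).symm

theorem fracVal_apply (k : FracMat) : fracVal k = (k.2 : ℚ)⁻¹ • ratMat k.1 :=
  rfl

theorem fracVal_intCast (x : IntMat) : fracVal (x, 1) = ratMat x := by
  simp [fracVal_apply]

theorem fracEq_iff (hk : k.2 ≠ 0) (hl : l.2 ≠ 0) : FracEq k l ↔ fracVal k = fracVal l := by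
  have hk' : (k.2 : ℚ) ≠ 0 := Nat.cast_ne_zero.2 hk
  have hl' : (l.2 : ℚ) ≠ 0 := Nat.cast_ne_zero.2 hl
  rw [FracEq, ← ratMat_injective.eq_iff, ratMat_smul, ratMat_smul, Int.cast_natCast,
    Int.cast_natCast, fracVal_apply, fracVal_apply, inv_smul_eq_iff₀ hk', smul_comm,
    eq_inv_smul_iff₀ hl']

theorem abs_det_fracVal (k : FracMat) :
    |(fracVal k).det| = (k.1.det.natAbs : ℚ) / ((k.2 * k.2 : ℕ) : ℚ) := by
  rw [fracVal_apply, Matrix.det_smul, det_ratMat, abs_mul, Nat.cast_natAbs, Int.cast_abs,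
    Fintype.card_fin, inv_pow, abs_of_nonneg (by positivity), inv_mul_eq_div]
  push_cast
  rw [sq]

theorem detExceeds_iff (hk : k.2 ≠ 0) (hg : g.2 ≠ 0) :
    DetExceeds k g ↔ |(fracVal g).det| < |(fracVal k).det| := by
  rw [abs_det_fracVal, abs_det_fracVal, div_lt_div_iff₀ (by positivity) (by positivity),
    DetExceeds]
  norm_cast

theorem admissible_iff (hk : k.2 ≠ 0) :
    Admissible k ↔ 1 < |(fracVal k).det| ∨ k.2 = 1 ∧ |(fracVal k).det| = 1 := by
  rw [Admissible, and_iff_right hk, abs_det_fracVal, one_lt_div (by positivity), Nat.cast_lt]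
  refine or_congr_right (and_congr_right fun h1 => ?_)
  rw [h1, mul_one, Nat.cast_one, div_one, Nat.cast_eq_one]

theorem Admissible.one_le_abs_det (hk : Admissible k) : 1 ≤ |(fracVal k).det| :=
  ((admissible_iff hk.1).1 hk).elim le_of_lt fun h => h.2.ge

theorem det_ne_zero_of_one_le_abs_det (hk : 1 ≤ |(fracVal k).det|) : k.1.det ≠ 0 := by
  intro h
  rw [abs_det_fracVal, h] at hk
  norm_num at hk

/-- The rational matrices of the elements of Sanov's subgroup, parametrized by the free group. -/
def sanovMat : FreeGroup (Fin 2) →* Matrix (Fin 2) (Fin 2) ℚ :=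
  (ratMat : IntMat →* Matrix (Fin 2) (Fin 2) ℚ).comp
    (Matrix.SpecialLinearGroup.coeMonoidHom.comp sanov)

theorem sanovMat_apply (w : FreeGroup (Fin 2)) : sanovMat w = ratMat (sanov w : IntMat) :=
  rfl

theorem sanovMat_injective : Function.Injective sanovMat :=
  ratMat_injective.comp (Matrix.SpecialLinearGroup.coeMonoidHom_injective.comp sanov_injective)

theorem det_sanovMat (w : FreeGroup (Fin 2)) : (sanovMat w).det = 1 := by
  rw [sanovMat_apply, det_ratMat, Matrix.SpecialLinearGroup.det_coe, Int.cast_one]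

theorem fracVal_sanov_mul (w : FreeGroup (Fin 2)) (k : FracMat) :
    fracVal (((sanov w : IntMat), 1) * k) = sanovMat w * fracVal k := by
  rw [map_mul, fracVal_intCast, sanovMat_apply]

theorem fracEq_intCast_mul_iff (hd : k.1.det ≠ 0) (y : IntMat) :
    FracEq ((y, 1) * k) g ↔
      (k.2 : ℤ) • (g.1 * k.1.adjugate) = ((g.2 : ℤ) * k.1.det) • y := by
  simp only [FracEq, Prod.fst_mul, Prod.snd_mul, one_mul]
  constructor
  · intro h
    rw [← smul_mul_assoc, ← h, smul_mul_assoc, mul_assoc, Matrix.mul_adjugate, Matrix.mul_smul,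
      mul_one, smul_smul]
  · intro h
    have hk : k.1.det • (k.2 : ℤ) • g.1 = k.1.det • (g.2 : ℤ) • (y * k.1) := by
      have := congrArg (· * k.1) h
      simpa only [smul_mul_assoc, mul_assoc, Matrix.adjugate_mul, Matrix.mul_smul, mul_one,
        smul_smul, mul_comm] using this
    exact (smul_right_injective _ hd hk).symm

theorem exists_eq_smul_sanov_iff {A : IntMat} {δ : ℤ} (hδ : δ ≠ 0) :
    (∃ w, A = δ • (sanov w : IntMat)) ↔ A.det = δ * δ ∧
      4 * δ ∣ A 0 0 - δ ∧ 2 * δ ∣ A 0 1 ∧ 2 * δ ∣ A 1 0 ∧ 2 * δ ∣ A 1 1 - δ := by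
  constructor
  · rintro ⟨w, rfl⟩
    obtain ⟨h00, h01, h10, h11⟩ := sanovCongr_sanov w
    refine ⟨by rw [Matrix.det_smul, Matrix.SpecialLinearGroup.det_coe, Fintype.card_fin, mul_one,
      sq], ?_⟩
    simp only [Matrix.smul_apply, smul_eq_mul, mul_comm _ δ, ← mul_sub_one,
      mul_dvd_mul_iff_left hδ]
    omega
  · rintro ⟨hdet, ⟨a, ha⟩, ⟨b, hb⟩, ⟨c, hc⟩, ⟨d, hd⟩⟩
    have hA : A = δ • !![4 * a + 1, 2 * b; 2 * c, 2 * d + 1] := by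
      ext i j
      fin_cases i <;> fin_cases j <;> simp <;> linarith
    have hone : (!![4 * a + 1, 2 * b; 2 * c, 2 * d + 1] : IntMat).det = 1 := by
      rw [hA, Matrix.det_smul, Fintype.card_fin, ← sq] at hdet
      exact mul_left_cancel₀ (pow_ne_zero 2 hδ) (hdet.trans (mul_one _).symm)
    obtain ⟨w, hw⟩ := exists_sanov_eq (m := ⟨_, hone⟩) (by simp [SanovCongr])
    exact ⟨w, by rw [hw, hA]⟩

theorem sanovEquiv_iff (hk : k.2 ≠ 0) (hg : g.2 ≠ 0) (hd : k.1.det ≠ 0) :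
    SanovEquiv k g ↔ ∃ w, fracVal g = sanovMat w * fracVal k := by
  have hδ : (g.2 : ℤ) * k.1.det ≠ 0 := mul_ne_zero (Nat.cast_ne_zero.2 hg) hd
  refine (exists_eq_smul_sanov_iff hδ).symm.trans (exists_congr fun w => ?_)
  rw [← fracEq_intCast_mul_iff hd, fracEq_iff (by simpa using hk) hg, fracVal_sanov_mul, eq_comm]

end Values

/-! ### Certificates of non-membership -/

/-- Sanov's two generators and their inverses. -/
def sanovGens : List IntMat :=
  (List.finRange 2).flatMap fun i => [(sanovGen i : IntMat), ((sanovGen i)⁻¹ : SL(2, ℤ))]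

/-- The products of at most `N` of Sanov's generators and their inverses. -/
def sanovBall : ℕ → List IntMat
  | 0 => [1]
  | N + 1 => sanovBall N ++ (sanovBall N).flatMap fun m => sanovGens.map fun x => x * m

/-- The fraction with the entries of `a` over the product of their denominators. -/
def commonDen (a : MatCode) : FracMat :=
  (!![a.1.1.1 * (a.1.2.2 * a.2.1.2 * a.2.2.2), a.1.2.1 * (a.1.1.2 * a.2.1.2 * a.2.2.2);
      a.2.1.1 * (a.1.1.2 * a.1.2.2 * a.2.2.2), a.2.2.1 * (a.1.1.2 * a.1.2.2 * a.2.1.2)],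
    a.1.1.2 * a.1.2.2 * (a.2.1.2 * a.2.2.2))

/-- A remaining product of rational expressions and, up to multiplication by Sanov's subgroup on
the left, the factor which has been split off before. -/
abbrev Node : Type := Stack MatCode × FracMat

/-- An edge `(u, x, v)` is labelled by an element `x` of Sanov's subgroup. It records that some
moves lead from `u.1` to `v.1` and split off a factor `k` with `u.2 * k = x * v.2`. -/
abbrev Edge : Type := Node × IntMat × Node

/-- Every move from a node in `V` either makes the determinant exceed that of `g` or leads to a
node in `V` along an edge in `E`. -/
def StepClosed (g : FracMat) (N : ℕ) (V : List Node) (E : List Edge) : Prop :=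
  ∀ u ∈ V, ∀ p ∈ next commonDen u.1, DetExceeds (u.2 * p.1) g ∨
    ∃ v ∈ V, (v.1 = p.2 ∧ v.2.2 ≠ 0) ∧
      ∃ x ∈ sanovBall N, (u, x, v) ∈ E ∧ FracEq (u.2 * p.1) ((x, 1) * v.2)

/-- Consecutive edges in `E` compose to an edge in `E` unless its label leaves the ball. -/
def CompClosed (N : ℕ) (E : List Edge) : Prop :=
  ∀ e ∈ E, ∀ f ∈ E, e.2.2 = f.1 → e.2.1 * f.2.1 ∈ sanovBall N → (e.1, e.2.1 * f.2.1, f.2.2) ∈ E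

/-- No edge in `E` from the initial node leads to a final node in such a way that `g` is the factor
which is split off. -/
def Avoids (s : Stack MatCode) (g : FracMat) (N : ℕ) (V : List Node) (E : List Edge) : Prop :=
  ∀ u ∈ V, u.1 = [] → ¬SanovEquiv u.2 g ∨
    ∃ x ∈ sanovBall N, FracEq ((x, 1) * u.2) g ∧ ((s, 1), x, u) ∉ E

/-- The lists `V` of nodes and `E` of edges, with labels in the ball of radius `N`, certify that
`g` is not in the set described by `s`. -/
def Refutes (s : Stack MatCode) (g : FracMat) (N : ℕ) (V : List Node) (E : List Edge) : Prop :=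
  ((s, 1) ∈ V ∧ ∀ u ∈ V, (u, 1, u) ∈ E) ∧ StepClosed g N V E ∧ CompClosed N E ∧ Avoids s g N V E

section PrimrecCertificates

variable {α : Type*} [Primcodable α]

@[fun_prop]
theorem primrec_sanovBall {n : α → ℕ} (hn : Primrec n) : Primrec fun a => sanovBall (n a) := by
  have h : Primrec fun p : ℕ × List IntMat =>
      p.2 ++ p.2.flatMap fun m => sanovGens.map fun x => x * m := by
    fun_prop
  refine ((Primrec.nat_rec₁ [1] h.to₂).of_eq fun n => ?_).comp hn
  induction n with
  | zero => rfl
  | succ n ih => simp only [sanovBall, ← ih]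

@[fun_prop]
theorem primrec_commonDen {a : α → MatCode} (ha : Primrec a) :
    Primrec fun c => commonDen (a c) := by
  refine Primrec.pair (primrec_matrix fun i j => ?_) (by fun_prop)
  fin_cases i <;> fin_cases j <;> dsimp <;> fun_prop

variable {s : α → Stack MatCode} {g : α → FracMat} {N : α → ℕ} {V : α → List Node}
  {E : α → List Edge}

theorem primrecPred_stepClosed (hg : Primrec g) (hN : Primrec N) (hV : Primrec V)
    (hE : Primrec E) : PrimrecPred fun a => StepClosed (g a) (N a) (V a) (E a) := by
  unfold StepClosed
  fun_prop

theorem primrecPred_compClosed (hN : Primrec N) (hE : Primrec E) :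
    PrimrecPred fun a => CompClosed (N a) (E a) := by
  unfold CompClosed
  fun_prop

theorem primrecPred_avoids (hs : Primrec s) (hg : Primrec g) (hN : Primrec N) (hV : Primrec V)
    (hE : Primrec E) : PrimrecPred fun a => Avoids (s a) (g a) (N a) (V a) (E a) := by
  unfold Avoids
  fun_prop

theorem primrecPred_refutes (hs : Primrec s) (hg : Primrec g) (hN : Primrec N) (hV : Primrec V)
    (hE : Primrec E) : PrimrecPred fun a => Refutes (s a) (g a) (N a) (V a) (E a) := by
  have := primrecPred_stepClosed hg hN hV hE
  have := primrecPred_compClosed hN hE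
  have := primrecPred_avoids hs hg hN hV hE
  unfold Refutes
  fun_prop

end PrimrecCertificates

/-! ### Soundness of certificates -/

section Certificates

variable {s t : Stack MatCode} {k g : FracMat} {N : ℕ}

theorem mem_sanovGens {x : IntMat} :
    x ∈ sanovGens ↔ ∃ a : Fin 2 × Bool, (sanov (FreeGroup.mk [a]) : IntMat) = x := by
  simp only [sanovGens, List.mem_flatMap, List.mem_finRange, true_and, List.mem_pair, Prod.exists,
    Bool.exists_bool, sanov, FreeGroup.lift_mk, List.map_singleton, List.prod_singleton, cond_true,
    cond_false]
  exact exists_congr fun i => by rw [or_comm, eq_comm, @eq_comm _ x]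

theorem mem_sanovBall {x : IntMat} :
    x ∈ sanovBall N ↔ ∃ w, w.norm ≤ N ∧ (sanov w : IntMat) = x := by
  suffices h : x ∈ sanovBall N ↔
      ∃ L : List (Fin 2 × Bool), L.length ≤ N ∧ (sanov (FreeGroup.mk L) : IntMat) = x by
    rw [h]
    constructor
    · rintro ⟨L, hL, rfl⟩
      exact ⟨_, FreeGroup.norm_mk_le.trans hL, rfl⟩
    · rintro ⟨w, hw, rfl⟩
      exact ⟨w.toWord, hw, by rw [FreeGroup.mk_toWord]⟩
  have hcons (a) (L : List (Fin 2 × Bool)) : (sanov (FreeGroup.mk (a :: L)) : IntMat) =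
      sanov (FreeGroup.mk [a]) * sanov (FreeGroup.mk L) := by
    rw [← Matrix.SpecialLinearGroup.coe_mul, ← map_mul, FreeGroup.mul_mk, List.singleton_append]
  induction N generalizing x with
  | zero =>
    have hnil : FreeGroup.mk ([] : List (Fin 2 × Bool)) = 1 := FreeGroup.one_eq_mk.symm
    simp [sanovBall, List.length_eq_zero_iff, hnil, eq_comm (a := x)]
  | succ N ih =>
    simp only [sanovBall, List.mem_append, List.mem_flatMap, List.mem_map, ih, mem_sanovGens]
    constructor
    · rintro (⟨L, hL, rfl⟩ | ⟨_, ⟨L, hL, rfl⟩, _, ⟨a, rfl⟩, rfl⟩)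
      · exact ⟨L, by omega, rfl⟩
      · exact ⟨a :: L, by simpa using hL, hcons a L⟩
    · rintro ⟨_ | ⟨a, L⟩, hL, rfl⟩
      · exact .inl ⟨[], by simp, rfl⟩
      · exact .inr ⟨_, ⟨L, by simpa using hL, rfl⟩, _, ⟨a, rfl⟩, (hcons a L).symm⟩

theorem sanov_mem_sanovBall {w : FreeGroup (Fin 2)} :
    (sanov w : IntMat) ∈ sanovBall N ↔ w.norm ≤ N := by
  rw [mem_sanovBall]
  constructor
  · rintro ⟨v, hv, h⟩
    rwa [← sanov_injective (Subtype.ext h)]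
  · exact fun h => ⟨w, h, rfl⟩

/-- Every letter which can be split off from `s` lies in `P(2,ℚ)`. -/
def IsAdmissible (s : Stack MatCode) : Prop :=
  ∀ k t, Unfolds commonDen s k t → ∀ p ∈ next commonDen t, Admissible p.1

theorem Unfolds.den_ne_zero (h : Unfolds commonDen s k t) (hs : IsAdmissible s) : k.2 ≠ 0 := by
  induction h with
  | refl => simp
  | step p h hp ih => exact mul_ne_zero ih (hs _ _ h p hp).1

theorem abs_det_fracVal_le_mul {l : FracMat} (hl : Admissible l) :
    |(fracVal k).det| ≤ |(fracVal (k * l)).det| := by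
  rw [map_mul, Matrix.det_mul, abs_mul]
  exact le_mul_of_one_le_right (abs_nonneg _) hl.one_le_abs_det

theorem Unfolds.one_le_abs_det (h : Unfolds commonDen s k t) (hs : IsAdmissible s) :
    1 ≤ |(fracVal k).det| := by
  induction h with
  | refl => simp
  | step p h hp ih => exact ih.trans (abs_det_fracVal_le_mul (hs _ _ h p hp))

/-- The edges in `E` with labels in the ball of radius `N`, labelled by the free group. -/
def FreeEdge (N : ℕ) (E : List Edge) (u : Node) (w : FreeGroup (Fin 2)) (v : Node) : Prop :=
  w.norm ≤ N ∧ (u, (sanov w : IntMat), v) ∈ E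

variable {V : List Node} {E : List Edge}

theorem StepClosed.exists_edgePath (hE : StepClosed g N V E) (hs : IsAdmissible s)
    (hg : g.2 ≠ 0) (hs0 : (s, 1) ∈ V) (h : Unfolds commonDen s k t)
    (hk : |(fracVal k).det| ≤ |(fracVal g).det|) :
    ∃ v ∈ V, v.1 = t ∧ v.2.2 ≠ 0 ∧ ∃ l : List (FreeGroup (Fin 2)),
      EdgePath (FreeEdge N E) (s, 1) l v ∧ fracVal k = sanovMat l.prod * fracVal v.2 := by
  induction h with
  | refl => exact ⟨_, hs0, rfl, by simp, [], rfl, by simp⟩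
  | step p h hp ih =>
    have hadm := hs _ _ h p hp
    obtain ⟨v, hv, rfl, hv2, l, hl, hkv⟩ := ih ((abs_det_fracVal_le_mul hadm).trans hk)
    have hden : (v.2 * p.1).2 ≠ 0 := mul_ne_zero hv2 hadm.1
    rw [map_mul, hkv, mul_assoc, ← map_mul] at hk ⊢
    rcases hE v hv p hp with hex | ⟨v', hv', ⟨h1, h2⟩, x, hx, hxE, hxv⟩
    · rw [detExceeds_iff hden hg] at hex
      rw [Matrix.det_mul, det_sanovMat, one_mul] at hk
      exact absurd hk hex.not_ge
    · obtain ⟨w, hw, rfl⟩ := mem_sanovBall.1 hx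
      refine ⟨v', hv', h1, h2, l ++ [w], edgePath_append.2 ⟨v, hl, v', ⟨hw, hxE⟩, rfl⟩, ?_⟩
      rw [fracEq_iff hden (by simpa using h2), fracVal_sanov_mul] at hxv
      rw [hxv, List.prod_append, List.prod_singleton, map_mul sanovMat, mul_assoc]

theorem CompClosed.freeEdge_of_edgePath (hE : CompClosed N E) {u v : Node} (hu : (u, 1, u) ∈ E)
    {l : List (FreeGroup (Fin 2))} (hl : EdgePath (FreeEdge N E) u l v)
    (hN : l.prod.norm ≤ N) : FreeEdge N E u l.prod v := by
  refine edge_of_edgePath (N := N) (fun _ _ _ h => h.1) ?_ ?_ hl hN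
  · intro u a m b n ha hb hab
    have hball := sanov_mem_sanovBall.2 hab
    refine ⟨hab, ?_⟩
    rw [map_mul, Matrix.SpecialLinearGroup.coe_mul] at hball ⊢
    exact hE _ ha.2 _ hb.2 rfl hball
  · exact ⟨by simp, by simpa using hu⟩

theorem Refutes.fracVal_ne (hE : Refutes s g N V E) (hs : IsAdmissible s) (hg : g.2 ≠ 0)
    (hk : Unfolds commonDen s k []) : fracVal k ≠ fracVal g := by
  intro hkg
  obtain ⟨⟨hs0, hrefl⟩, hstep, hcomp, hav⟩ := hE
  obtain ⟨v, hv, hnil, hv2, l, hl, hkv⟩ := hstep.exists_edgePath hs hg hs0 hk (by rw [hkg])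
  have hdet : 1 ≤ |(fracVal v.2).det| := by
    simpa [hkv, Matrix.det_mul, det_sanovMat] using hk.one_le_abs_det hs
  have hequiv : SanovEquiv v.2 g :=
    (sanovEquiv_iff hv2 hg (det_ne_zero_of_one_le_abs_det hdet)).2 ⟨l.prod, by rw [← hkg, hkv]⟩
  obtain ⟨x, hx, hxg, hxE⟩ := (hav v hv hnil).resolve_left (not_not.2 hequiv)
  obtain ⟨w, hw, rfl⟩ := mem_sanovBall.1 hx
  have hunit : IsUnit (fracVal v.2) :=
    (Matrix.isUnit_iff_isUnit_det _).2 (isUnit_iff_ne_zero.2 (abs_pos.1 (one_pos.trans_le hdet)))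
  have hwl : w = l.prod := sanovMat_injective <| hunit.mul_right_cancel <| by
    rw [← hkv, hkg, ← fracVal_sanov_mul]
    exact (fracEq_iff (by simpa using hv2) hg).1 hxg
  subst hwl
  exact hxE (hcomp.freeEdge_of_edgePath (hrefl _ hs0) hl hw).2

end Certificates

/-! ### Existence of certificates -/

section Reachability

theorem exists_lt_forall_le_of_finite {α : Type*} [LinearOrder α] [NoMaxOrder α] {S : Set α}
    (hS : S.Finite) (a : α) : ∃ δ, a < δ ∧ ∀ b ∈ S, a < b → δ ≤ b := by
  rcases {b ∈ S | a < b}.eq_empty_or_nonempty with hempty | hne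
  · obtain ⟨δ, hδ⟩ := exists_gt a
    exact ⟨δ, hδ, fun b hb hab => (Set.eq_empty_iff_forall_notMem.1 hempty b ⟨hb, hab⟩).elim⟩
  · obtain ⟨δ, hδ, hmin⟩ := Set.exists_min_image _ id (hS.sep _) hne
    exact ⟨δ, hδ.2, fun b hb hab => hmin b ⟨hb, hab⟩⟩

theorem finite_setOf_letter {α M : Type*} [Monoid M] (φ : α → M) (s : Stack α) :
    {l | ∃ k t, Unfolds φ s k t ∧ ∃ p ∈ next φ t, p.1 = l}.Finite := by
  refine ((finite_setOf_unfolds φ s).biUnion fun t _ =>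
    ((next φ t).map Prod.fst).finite_toSet).subset ?_
  rintro _ ⟨k, t, h, p, hp, rfl⟩
  exact Set.mem_biUnion (⟨k, h⟩ : ∃ k, Unfolds φ s k t) (List.mem_map_of_mem hp)

theorem exists_smul_fracVal_mem_range {Λ : Set FracMat} (hΛ : Λ.Finite)
    (h0 : ∀ l ∈ Λ, l.2 ≠ 0) :
    ∃ D : ℕ, D ≠ 0 ∧ ∀ l ∈ Λ, (D : ℚ) • fracVal l ∈ ratMat.range := by
  refine ⟨∏ l ∈ hΛ.toFinset, l.2, Finset.prod_ne_zero_iff.2 fun l hl =>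
    h0 l (hΛ.mem_toFinset.1 hl), fun l hl => ?_⟩
  obtain ⟨e, he⟩ : l.2 ∣ ∏ l ∈ hΛ.toFinset, l.2 :=
    Finset.dvd_prod_of_mem Prod.snd (hΛ.mem_toFinset.2 hl)
  have hl0 : (l.2 : ℚ) ≠ 0 := Nat.cast_ne_zero.2 (h0 l hl)
  refine ⟨(e : ℤ) • l.1, ?_⟩
  rw [ratMat_smul, fracVal_apply, smul_smul, he]
  congr 1
  push_cast
  field_simp

theorem smul_mul_mem_range {c d : ℚ} {A B : Matrix (Fin 2) (Fin 2) ℚ}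
    (hA : c • A ∈ ratMat.range) (hB : d • B ∈ ratMat.range) :
    (c * d) • (A * B) ∈ ratMat.range := by
  rw [← smul_mul_smul_comm]
  exact mul_mem hA hB

variable {s t : Stack MatCode} {k g : FracMat}

/-- Only letters of determinant `±1` leave the denominator alone; every other letter multiplies
the determinant by at least `δ`. -/
theorem Unfolds.exists_pow_smul_mem_range (h : Unfolds commonDen s k t) (hs : IsAdmissible s)
    {D δ : ℚ} (hδ : 0 ≤ δ)
    (hD : ∀ k t, Unfolds commonDen s k t → ∀ p ∈ next commonDen t,
      D • fracVal p.1 ∈ ratMat.range)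
    (hδs : ∀ k t, Unfolds commonDen s k t → ∀ p ∈ next commonDen t,
      1 < |(fracVal p.1).det| → δ ≤ |(fracVal p.1).det|) :
    ∃ m : ℕ, D ^ m • fracVal k ∈ ratMat.range ∧ δ ^ m ≤ |(fracVal k).det| := by
  induction h with
  | refl => exact ⟨0, by simp [one_mem], by simp⟩
  | step p h hp ih =>
    obtain ⟨m, hm, hδm⟩ := ih
    simp only [map_mul, Matrix.det_mul, abs_mul]
    rcases (admissible_iff (hs _ _ h p hp).1).1 (hs _ _ h p hp) with h1 | ⟨h1, h2⟩
    · refine ⟨m + 1, ?_, ?_⟩ <;> rw [pow_succ]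
      · exact smul_mul_mem_range hm (hD _ _ h p hp)
      · exact mul_le_mul hδm (hδs _ _ h p hp h1) hδ (abs_nonneg _)
    · refine ⟨m, ?_, by rwa [h2, mul_one]⟩
      have hint : (1 : ℚ) • fracVal p.1 ∈ ratMat.range := by simp [fracVal_apply, h1]
      simpa using smul_mul_mem_range hm hint

theorem IsAdmissible.exists_common_denominator (hs : IsAdmissible s) (b : ℚ) :
    ∃ D : ℕ, D ≠ 0 ∧ ∀ k t, Unfolds commonDen s k t → |(fracVal k).det| ≤ b →
      (D : ℚ) • fracVal k ∈ ratMat.range := by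
  have hΛ := finite_setOf_letter commonDen s
  obtain ⟨δ, hδ, hδs⟩ := exists_lt_forall_le_of_finite (hΛ.image fun l => |(fracVal l).det|) 1
  obtain ⟨D, hD0, hD⟩ := exists_smul_fracVal_mem_range hΛ <| by
    rintro _ ⟨k, t, h, p, hp, rfl⟩
    exact (hs k t h p hp).1
  obtain ⟨M, hM⟩ := pow_unbounded_of_one_lt b hδ
  refine ⟨D ^ M, pow_ne_zero M hD0, fun k t h hkb => ?_⟩
  obtain ⟨m, hm, hδm⟩ := h.exists_pow_smul_mem_range hs (zero_le_one.trans hδ.le)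
    (fun k t h p hp => hD _ ⟨k, t, h, p, hp, rfl⟩)
    (fun k t h p hp => hδs _ ⟨_, ⟨k, t, h, p, hp, rfl⟩, rfl⟩)
  have hmM : m < M := (pow_lt_pow_iff_right₀ hδ).1 ((hδm.trans hkb).trans_lt hM)
  have hpow : ((D ^ M : ℕ) : ℚ) • fracVal k = (D ^ (M - m) : ℕ) • (D : ℚ) ^ m • fracVal k := by
    rw [← Nat.cast_smul_eq_nsmul ℚ, smul_smul]
    norm_cast
    rw [← pow_add, Nat.sub_add_cancel hmM.le]
  rw [hpow]
  exact nsmul_mem hm _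

theorem exists_ratMat_eq_sanovMat_mul {x y : IntMat} (h0 : x.det ≠ 0) (hdet : y.det = x.det)
    (h : ∀ i j, 4 * x.det ∣ y i j - x i j) : ∃ w, ratMat y = sanovMat w * ratMat x := by
  choose z hz using h
  obtain ⟨n, hy⟩ : ∃ n : IntMat, y = (1 + (4 : ℤ) • n) * x := by
    refine ⟨Matrix.of z * x.adjugate, ?_⟩
    rw [add_mul, one_mul, smul_mul_assoc, mul_assoc, Matrix.adjugate_mul, Matrix.mul_smul,
      mul_one, smul_smul]
    ext i j
    simp [← hz]
  have hone : (1 + (4 : ℤ) • n).det = 1 := by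
    rw [hy, Matrix.det_mul] at hdet
    exact mul_right_cancel₀ h0 (hdet.trans (one_mul _).symm)
  obtain ⟨w, hw⟩ := exists_sanov_eq (m := ⟨1 + (4 : ℤ) • n, hone⟩)
    (by simp [SanovCongr, -zsmul_eq_mul]; omega)
  exact ⟨w, by rw [sanovMat_apply, hw, ← map_mul, ← hy]⟩

/-- An invariant of integer matrices which, for nonzero determinant, separates the orbits of
Sanov's subgroup and takes finitely many values for every bound on the determinant. -/
def sanovKey (x : IntMat) : ℤ × IntMat :=
  (x.det, x.map (· % (4 * x.det)))

theorem exists_ratMat_eq_sanovMat_mul_of_sanovKey_eq {x y : IntMat} (h0 : x.det ≠ 0)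
    (h : sanovKey x = sanovKey y) : ∃ w, ratMat y = sanovMat w * ratMat x := by
  obtain ⟨hdet, hmod⟩ := Prod.ext_iff.1 h
  refine exists_ratMat_eq_sanovMat_mul h0 hdet.symm fun i j => Int.ModEq.dvd ?_
  have := congrFun₂ hmod i j
  simp only [sanovKey, Matrix.map_apply] at this hdet
  rwa [← hdet] at this

theorem finite_image_sanovKey (b : ℤ) :
    (sanovKey '' {x | x.det ≠ 0 ∧ |x.det| ≤ b}).Finite := by
  refine ((Set.finite_Icc (-b) b).prod (Set.Finite.pi' fun _ : Fin 2 =>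
    Set.Finite.pi' fun _ : Fin 2 => Set.finite_Ico 0 (4 * b))).subset ?_
  rintro _ ⟨x, ⟨hx0, hxb⟩, rfl⟩
  have h4 : 4 * x.det ≠ 0 := mul_ne_zero four_ne_zero hx0
  refine ⟨abs_le.1 hxb, fun i j => ⟨Int.emod_nonneg _ h4, (Int.emod_lt_abs _ h4).trans_le ?_⟩⟩
  rw [abs_mul]
  exact mul_le_mul_of_nonneg_left hxb zero_le_four

theorem IsAdmissible.exists_finite_cover (hs : IsAdmissible s) (b : ℚ) :
    ∃ V : Set Node, V.Finite ∧ (∀ u ∈ V, Unfolds commonDen s u.2 u.1) ∧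
      ∀ k t, Unfolds commonDen s k t → |(fracVal k).det| ≤ b →
        ∃ v ∈ V, v.1 = t ∧ ∃ w, fracVal k = sanovMat w * fracVal v.2 := by
  obtain ⟨D, hD0, hD⟩ := hs.exists_common_denominator b
  have hDQ : (D : ℚ) ≠ 0 := Nat.cast_ne_zero.2 hD0
  let R : Set Node := {u | Unfolds commonDen s u.2 u.1 ∧ |(fracVal u.2).det| ≤ b}
  have hint (u : Node) (hu : u ∈ R) : ∃ y, ratMat y = (D : ℚ) • fracVal u.2 := hD _ _ hu.1 hu.2
  choose! y hy using hint
  have hdet (u : Node) (hu : u ∈ R) : ((y u).det : ℚ) = D ^ 2 * (fracVal u.2).det := by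
    rw [← det_ratMat, hy u hu, Matrix.det_smul, Fintype.card_fin]
  have hdet0 (u : Node) (hu : u ∈ R) : (y u).det ≠ 0 := by
    rw [← Int.cast_ne_zero (α := ℚ), hdet u hu]
    exact mul_ne_zero (pow_ne_zero 2 hDQ)
      (abs_pos.1 (one_pos.trans_le (hu.1.one_le_abs_det hs)))
  have hdetb (u : Node) (hu : u ∈ R) : |(y u).det| ≤ ⌈D ^ 2 * b⌉ := by
    rw [← Int.cast_le (R := ℚ), Int.cast_abs, hdet u hu, abs_mul, abs_of_nonneg (by positivity)]
    exact (mul_le_mul_of_nonneg_left hu.2 (by positivity)).trans (Int.le_ceil _)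
  let f (u : Node) : Stack MatCode × ℤ × IntMat := (u.1, sanovKey (y u))
  have hfin : (f '' R).Finite := by
    refine ((finite_setOf_unfolds commonDen s).prod
      (finite_image_sanovKey ⌈D ^ 2 * b⌉)).subset ?_
    rintro _ ⟨u, hu, rfl⟩
    exact ⟨⟨u.2, hu.1⟩, y u, ⟨hdet0 u hu, hdetb u hu⟩, rfl⟩
  obtain ⟨V, hVR, hV⟩ := Set.exists_subset_bijOn R f
  refine ⟨V, hV.finite_iff_finite.2 hfin, fun u hu => (hVR hu).1, fun k t hk hkb => ?_⟩
  have hkR : (t, k) ∈ R := ⟨hk, hkb⟩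
  obtain ⟨v, hv, hvf⟩ := hV.surjOn ⟨_, hkR, rfl⟩
  obtain ⟨hvt, hkey⟩ := Prod.ext_iff.1 hvf
  obtain ⟨w, hw⟩ := exists_ratMat_eq_sanovMat_mul_of_sanovKey_eq (hdet0 v (hVR hv)) hkey
  rw [hy _ hkR, hy _ (hVR hv), Matrix.mul_smul] at hw
  exact ⟨v, hv, hvt, w, smul_right_injective _ hDQ hw⟩

end Reachability

section Completeness

theorem exists_norm_bound {α X : Type*} [DecidableEq α] {S : Set X} (hS : S.Finite)
    (P : X → FreeGroup α → Prop) :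
    ∃ N, ∀ x ∈ S, (∃ w, P x w) → ∃ w, w.norm ≤ N ∧ P x w := by
  choose! w hw using fun x (hx : ∃ w, P x w) => hx
  obtain ⟨N, hN⟩ := (hS.image fun x => (w x).norm).bddAbove
  exact ⟨N, fun x hx hex => ⟨w x, hN ⟨x, hx, rfl⟩, hw x hex⟩⟩

/-- The edges between nodes in `V` which describe actual moves. -/
def SoundEdge (N : ℕ) (V : List Node) (e : Edge) : Prop :=
  (e.1 ∈ V ∧ e.2.1 ∈ sanovBall N ∧ e.2.2 ∈ V) ∧ ∃ k, Unfolds commonDen e.1.1 k e.2.2.1 ∧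
    fracVal (e.1.2 * k) = fracVal ((e.2.1, 1) * e.2.2.2)

theorem finite_setOf_soundEdge (N : ℕ) (V : List Node) : {e | SoundEdge N V e}.Finite :=
  (V.finite_toSet.prod ((sanovBall N).finite_toSet.prod V.finite_toSet)).subset
    fun _ he => he.1

variable {s : Stack MatCode} {g : FracMat} {N : ℕ} {V : List Node} {E : List Edge}

theorem compClosed_of_forall_mem_iff_soundEdge (hE : ∀ e, e ∈ E ↔ SoundEdge N V e) :
    CompClosed N E := by
  intro e he f hf hef hball
  rw [hE] at he hf ⊢
  obtain ⟨⟨he1, -, -⟩, k, hk, hek⟩ := he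
  obtain ⟨⟨-, -, hf3⟩, l, hl, hfl⟩ := hf
  rw [← hef] at hl hfl
  refine ⟨⟨he1, hball, hf3⟩, k * l, hk.trans hl, ?_⟩
  calc fracVal (e.1.2 * (k * l)) = fracVal (e.1.2 * k) * fracVal l := by
        rw [← mul_assoc, map_mul]
    _ = ratMat e.2.1 * fracVal (e.2.2.2 * l) := by
        rw [hek, map_mul, map_mul, fracVal_intCast, mul_assoc]
    _ = fracVal ((e.2.1 * f.2.1, 1) * f.2.2.2) := by
        rw [hfl, map_mul, map_mul, fracVal_intCast, fracVal_intCast, map_mul, mul_assoc]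

theorem stepClosed_of_forall_mem_iff_soundEdge (hE : ∀ e, e ∈ E ↔ SoundEdge N V e)
    (hs : IsAdmissible s) (hg : g.2 ≠ 0) (hV : ∀ u ∈ V, Unfolds commonDen s u.2 u.1)
    (hstep : ∀ u ∈ V, ∀ p ∈ next commonDen u.1,
      |(fracVal (u.2 * p.1)).det| ≤ |(fracVal g).det| → ∃ v ∈ V, v.1 = p.2 ∧
        ∃ w, w.norm ≤ N ∧ fracVal (u.2 * p.1) = sanovMat w * fracVal v.2) :
    StepClosed g N V E := by
  intro u hu p hp
  have hden := ((hV u hu).step p hp).den_ne_zero hs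
  rw [or_iff_not_imp_left, detExceeds_iff hden hg, not_lt]
  intro hle
  obtain ⟨v, hv, hvp, w, hw, hwv⟩ := hstep u hu p hp hle
  have hvden := (hV v hv).den_ne_zero hs
  have hball := sanov_mem_sanovBall.2 hw
  rw [← fracVal_sanov_mul] at hwv
  refine ⟨v, hv, ⟨hvp, hvden⟩, _, hball, ?_, (fracEq_iff hden (by simpa using hvden)).2 hwv⟩
  refine (hE _).2 ⟨⟨hu, hball, hv⟩, p.1, ?_, hwv⟩
  simpa [hvp] using Unfolds.refl.step p hp

theorem avoids_of_forall_mem_iff_soundEdge (hE : ∀ e, e ∈ E ↔ SoundEdge N V e)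
    (hs : IsAdmissible s) (hg : g.2 ≠ 0) (hV : ∀ u ∈ V, Unfolds commonDen s u.2 u.1)
    (hfin : ∀ u ∈ V, (∃ w, fracVal g = sanovMat w * fracVal u.2) →
      ∃ w, w.norm ≤ N ∧ fracVal g = sanovMat w * fracVal u.2)
    (hmem : ∀ k, Unfolds commonDen s k [] → fracVal k ≠ fracVal g) :
    Avoids s g N V E := by
  intro u hu hnil
  have hden := (hV u hu).den_ne_zero hs
  rw [or_iff_not_imp_left, not_not, sanovEquiv_iff hden hg
    (det_ne_zero_of_one_le_abs_det ((hV u hu).one_le_abs_det hs))]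
  intro hequiv
  obtain ⟨w, hw, hwg⟩ := hfin u hu hequiv
  rw [← fracVal_sanov_mul] at hwg
  refine ⟨_, sanov_mem_sanovBall.2 hw, (fracEq_iff (by simpa using hden) hg).2 hwg.symm, ?_⟩
  intro huE
  obtain ⟨-, k, hk, hkw⟩ := (hE _).1 huE
  rw [one_mul] at hkw
  exact hmem k (hnil ▸ hk) (hkw.trans hwg.symm)

theorem IsAdmissible.exists_nodes (hs : IsAdmissible s) (g : FracMat) :
    ∃ (N : ℕ) (V : List Node), (s, 1) ∈ V ∧ (∀ u ∈ V, Unfolds commonDen s u.2 u.1) ∧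
      (∀ u ∈ V, ∀ p ∈ next commonDen u.1,
        |(fracVal (u.2 * p.1)).det| ≤ |(fracVal g).det| → ∃ v ∈ V, v.1 = p.2 ∧
          ∃ w, w.norm ≤ N ∧ fracVal (u.2 * p.1) = sanovMat w * fracVal v.2) ∧
      ∀ u ∈ V, (∃ w, fracVal g = sanovMat w * fracVal u.2) →
        ∃ w, w.norm ≤ N ∧ fracVal g = sanovMat w * fracVal u.2 := by
  obtain ⟨V₀, hV₀fin, hV₀, hcover⟩ := hs.exists_finite_cover |(fracVal g).det|
  obtain ⟨V, hV⟩ : ∃ V : List Node, ∀ u, u ∈ V ↔ u ∈ insert (s, 1) V₀ :=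
    ⟨(hV₀fin.insert (s, 1)).toFinset.toList, by simp⟩
  have hunf : ∀ u ∈ V, Unfolds commonDen s u.2 u.1 := fun u hu =>
    ((hV u).1 hu).elim (fun h => h ▸ .refl) (hV₀ u)
  let X : Set FracMat := insert g (Set.image2 (fun u l => u.2 * l) {u | u ∈ V}
    {l | ∃ k t, Unfolds commonDen s k t ∧ ∃ p ∈ next commonDen t, p.1 = l})
  have hX : X.Finite := (V.finite_toSet.image2 _ (finite_setOf_letter commonDen s)).insert g
  obtain ⟨N, hN⟩ := exists_norm_bound (hX.prod V.finite_toSet)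
    fun x w => fracVal x.1 = sanovMat w * fracVal x.2.2
  refine ⟨N, V, (hV _).2 (.inl rfl), hunf, fun u hu p hp hle => ?_, fun u hu => ?_⟩
  · obtain ⟨v, hv, hvp, hw⟩ := hcover _ _ ((hunf u hu).step p hp) hle
    have hvV : v ∈ V := (hV v).2 (.inr hv)
    exact ⟨v, hvV, hvp, hN (_, v) ⟨.inr ⟨u, hu, _, ⟨_, _, hunf u hu, p, hp, rfl⟩, rfl⟩, hvV⟩ hw⟩
  · exact hN (g, u) ⟨.inl rfl, hu⟩

theorem exists_refutes (hs : IsAdmissible s) (hg : g.2 ≠ 0)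
    (hmem : ∀ k, Unfolds commonDen s k [] → fracVal k ≠ fracVal g) :
    ∃ N V E, Refutes s g N V E := by
  obtain ⟨N, V, hsV, hunf, hstep, hfin⟩ := hs.exists_nodes g
  obtain ⟨E, hE⟩ : ∃ E : List Edge, ∀ e, e ∈ E ↔ SoundEdge N V e :=
    ⟨(finite_setOf_soundEdge N V).toFinset.toList, by simp⟩
  refine ⟨N, V, E, ⟨hsV, fun u hu => (hE _).2 ⟨⟨hu, ?_, hu⟩, 1, .refl, ?_⟩⟩,
    stepClosed_of_forall_mem_iff_soundEdge hE hs hg hunf hstep,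
    compClosed_of_forall_mem_iff_soundEdge hE,
    avoids_of_forall_mem_iff_soundEdge hE hs hg hunf hfin hmem⟩
  · exact mem_sanovBall.2 ⟨1, by simp, by simp⟩
  · rw [mul_one]
    exact congrArg _ (one_mul u.2).symm

end Completeness

/-! ### Reduction of flat rational expressions to products -/

section Expressions

variable {M : Type*} [Monoid M]

theorem IsRational.exists_ratSet {L : Set M} (hL : IsRational L) :
    ∃ E : RegularExpression M, ratSet E = L := by
  induction hL with
  | finite L hL =>
    induction L, hL using Set.Finite.induction_on with
    | empty => exact ⟨.zero, rfl⟩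
    | @insert a _ _ _ ih =>
      obtain ⟨E, rfl⟩ := ih
      exact ⟨.plus (.char a) E, rfl⟩
  | union _ _ _ _ hK hL =>
    obtain ⟨⟨E, rfl⟩, F, rfl⟩ := And.intro hK hL
    exact ⟨.plus E F, rfl⟩
  | mul _ _ _ _ hK hL =>
    obtain ⟨⟨E, rfl⟩, F, rfl⟩ := And.intro hK hL
    exact ⟨.comp E F, rfl⟩
  | star _ _ hL =>
    obtain ⟨E, rfl⟩ := hL
    exact ⟨.star E, rfl⟩

theorem IsFlatRational.exists_flatSet {N : Submonoid M} {R : Set M} (hR : IsFlatRational N R) :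
    ∃ E : FlatExpr M N, flatSet N E = R := by
  obtain ⟨F, hF, rfl⟩ := hR
  let factorSet (p : M × RegularExpression N) : M × Set N := (p.1, ratSet p.2)
  let termSet (T : RegularExpression N × List (M × RegularExpression N)) :
      Set N × List (M × Set N) := (ratSet T.1, T.2.map factorSet)
  have hmem : F ∈ Set.range (List.map termSet) := by
    rw [Set.range_list_map]
    intro T hT
    obtain ⟨E₀, hE₀⟩ := (hF T hT).1.exists_ratSet
    obtain ⟨l, hl⟩ : T.2 ∈ Set.range (List.map factorSet) := by
      rw [Set.range_list_map]
      intro p hp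
      obtain ⟨E, hE⟩ := ((hF T hT).2 p hp).exists_ratSet
      exact ⟨(p.1, E), Prod.ext rfl hE⟩
    exact ⟨(E₀, l), Prod.ext hE₀ hl⟩
  obtain ⟨E, rfl⟩ := hmem
  refine ⟨E, ?_⟩
  simp only [flatSet, List.mem_map, Set.iUnion_exists, Set.biUnion_and', Set.iUnion_iUnion_eq_right,
    termSet, factorSet]

theorem image_ratSet {N : Type*} [Monoid N] (f : M →* N) (E : RegularExpression M) :
    f '' ratSet E = ratSet (E.map f) := by
  induction E with
  | zero => exact Set.image_empty f
  | epsilon => simp only [ratSet, RegularExpression.map, Set.image_singleton, map_one]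
  | char a => exact Set.image_singleton
  | plus E F hE hF => simp only [ratSet, RegularExpression.map, Set.image_union, hE, hF]
  | comp E F hE hF => simp only [ratSet, RegularExpression.map, Set.image_mul, hE, hF]
  | star E hE =>
    simp only [ratSet, RegularExpression.map, ← hE, ← MonoidHom.map_mclosure, Submonoid.coe_map]

theorem image_stackSet {α N : Type*} [Monoid N] (f : M →* N) (φ : α → M) (s : Stack α) :
    f '' stackSet φ s = stackSet (f ∘ φ) s := by
  simp only [stackSet, Set.image_list_prod, List.map_map, Function.comp_def, image_ratSet,
    RegularExpression.map_map]

/-- All letters of the rational expression satisfy `A`. -/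
def AllLetters {α : Type*} (A : α → Prop) : RegularExpression α → Prop
  | .zero | .epsilon => True
  | .char a => A a
  | .plus E F | .comp E F => AllLetters A E ∧ AllLetters A F
  | .star E => AllLetters A E

theorem allLetters_map {α β : Type*} {A : β → Prop} {f : α → β} (hf : ∀ a, A (f a))
    (E : RegularExpression α) : AllLetters A (E.map f) := by
  induction E with
  | zero | epsilon => trivial
  | char a => exact hf a
  | plus _ _ hE hF | comp _ _ hE hF => exact ⟨hE, hF⟩
  | star _ hE => exact hE

theorem allLetters_of_mem_next {α : Type*} {φ : α → M} {A : M → Prop} (h1 : A 1) {s : Stack α}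
    (hs : ∀ E ∈ s, AllLetters (fun a => A (φ a)) E) {p : M × Stack α} (hp : p ∈ next φ s) :
    A p.1 ∧ ∀ E ∈ p.2, AllLetters (fun a => A (φ a)) E := by
  rcases s with _ | ⟨E, r⟩
  · exact absurd hp List.not_mem_nil
  · obtain ⟨hE, hr⟩ := List.forall_mem_cons.1 hs
    cases E <;>
      simp only [next, List.mem_cons, List.not_mem_nil, or_false, AllLetters] at hp hE <;>
      grind [AllLetters]

theorem Unfolds.forall_mem_next {α : Type*} {φ : α → M} {A : M → Prop} (h1 : A 1)
    {s t : Stack α} {k : M} (h : Unfolds φ s k t)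
    (hs : ∀ E ∈ s, AllLetters (fun a => A (φ a)) E) : ∀ p ∈ next φ t, A p.1 := by
  suffices ht : ∀ E ∈ t, AllLetters (fun a => A (φ a)) E from
    fun p hp => (allLetters_of_mem_next h1 ht hp).1
  induction h with
  | refl => exact hs
  | step p _ hp ih => exact (allLetters_of_mem_next h1 ih hp).2

end Expressions

section Descriptions

open Matrix

theorem commonDen_matCode_ne_zero (g : GL (Fin 2) ℚ) : (commonDen (matCode g)).2 ≠ 0 := by
  simp [commonDen, matCode, ratCode]

theorem fracVal_commonDen_matCode (g : GL (Fin 2) ℚ) :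
    fracVal (commonDen (matCode g)) = g.1 := by
  ext i j
  fin_cases i <;> fin_cases j <;>
    · simp [fracVal_apply, ratMat, commonDen, matCode, ratCode]
      field_simp
      exact (Rat.den_mul_eq_num _).symm

theorem admissible_matCode (h : P2Q) : Admissible (commonDen (matCode h)) := by
  rw [admissible_iff (commonDen_matCode_ne_zero _), fracVal_commonDen_matCode]
  refine h.2.imp_right fun hh => ⟨?_, abs_det_of_mem_GL2Z hh⟩
  obtain ⟨a, ha⟩ := hh
  have hden (i j : Fin 2) : (h.1.1 i j).den = 1 := by simp [← ha]
  simp [commonDen, matCode, ratCode, hden]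

/-- The description of the integer matrix obtained by multiplying by the common denominator. -/
def clearDen (a : MatCode) : MatCode :=
  let A : IntMat := (commonDen a).1
  (((A 0 0, 1), (A 0 1, 1)), ((A 1 0, 1), (A 1 1, 1)))

theorem commonDen_clearDen (a : MatCode) : commonDen (clearDen a) = ((commonDen a).1, 1) := by
  refine Prod.ext ?_ rfl
  ext i j
  fin_cases i <;> fin_cases j <;> simp [commonDen, clearDen]

theorem admissible_clearDen (g : GL (Fin 2) ℚ) :
    Admissible (commonDen (clearDen (matCode g))) := by
  rw [commonDen_clearDen]
  have hdet : (commonDen (matCode g)).1.det ≠ 0 := by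
    intro h0
    have hg := abs_det_fracVal (commonDen (matCode g))
    simp [h0, fracVal_commonDen_matCode, g.det_ne_zero] at hg
  refine ⟨one_ne_zero, ?_⟩
  have := Int.natAbs_ne_zero.2 hdet
  dsimp only
  omega

theorem fracVal_commonDen_clearDen (g : GL (Fin 2) ℚ) :
    fracVal (commonDen (clearDen (matCode g))) = ((commonDen (matCode g)).2 : ℚ) • g.1 := by
  have hden : ((commonDen (matCode g)).2 : ℚ) ≠ 0 :=
    Nat.cast_ne_zero.2 (commonDen_matCode_ne_zero g)
  rw [commonDen_clearDen, fracVal_intCast, ← fracVal_commonDen_matCode, fracVal_apply,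
    smul_inv_smul₀ hden]

/-- A term `E₀ g₁ E₁ ⋯ g_t E_t` of the description of a flat rational expression. -/
abbrev Term : Type :=
  RegularExpression MatCode × List (MatCode × RegularExpression MatCode)

/-- The product of expressions described by a term, where every `g_i` is replaced by an integral
multiple. -/
def termStack (T : Term) : Stack MatCode :=
  T.1 :: T.2.flatMap fun p => [.char (clearDen p.1), p.2]

/-- The product of the factors by which the `g_i` are multiplied in `termStack`. -/
def termDen (T : Term) : ℕ :=
  (T.2.map fun p => (commonDen p.1).2).prod

/-- The multiple of a matrix which is to be compared with the elements of `termStack`. -/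
def termTarget (a : MatCode) (T : Term) : FracMat :=
  ((termDen T : ℤ) • (commonDen a).1, (commonDen a).2)

/-- The description of a term of a flat rational expression. -/
def termCode (T : RegularExpression P2Q × List (GL (Fin 2) ℚ × RegularExpression P2Q)) : Term :=
  (T.1.map fun h : P2Q => matCode h,
    T.2.map fun p => (matCode p.1, p.2.map fun h : P2Q => matCode h))

variable (E : RegularExpression P2Q) (l : List (GL (Fin 2) ℚ × RegularExpression P2Q))
  (T : RegularExpression P2Q × List (GL (Fin 2) ℚ × RegularExpression P2Q))

theorem isAdmissible_termStack : IsAdmissible (termStack (termCode T)) := by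
  have hP (F : RegularExpression P2Q) :
      AllLetters (fun a => Admissible (commonDen a)) (F.map fun h : P2Q => matCode h) :=
    allLetters_map (A := fun a => Admissible (commonDen a)) admissible_matCode F
  refine fun k t h => h.forall_mem_next ⟨one_ne_zero, by simp⟩ fun F hF => ?_
  simp only [termStack, termCode, List.flatMap_map, List.mem_cons, List.mem_flatMap,
    List.not_mem_nil, or_false] at hF
  rcases hF with rfl | ⟨p, -, rfl | rfl⟩
  exacts [hP _, admissible_clearDen p.1, hP _]

theorem termDen_ne_zero : termDen (termCode T) ≠ 0 := by
  simp [termDen, termCode, commonDen_matCode_ne_zero]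

theorem ratSet_map_matCode :
    ratSet ((E.map fun h : P2Q => matCode h).map (fracVal ∘ commonDen)) =
      Units.coeHom _ '' ((↑) '' ratSet E : Set (GL (Fin 2) ℚ)) := by
  have hcoe : (fracVal ∘ commonDen) ∘ (fun h : P2Q => matCode h) =
      (Units.coeHom _).comp P2Q.subtype := funext fun h => fracVal_commonDen_matCode h.1
  rw [RegularExpression.map_map, hcoe, ← image_ratSet, Set.image_image]
  rfl

theorem stackSet_flatMap_clearDen :
    stackSet (fracVal ∘ commonDen)
        ((termCode (E, l)).2.flatMap fun p => [.char (clearDen p.1), p.2]) =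
      (termDen (termCode (E, l)) : ℚ) • Units.coeHom _ '' ((l.map fun p => (p.1, ratSet p.2)).map
        fun p => ({p.1} : Set (GL (Fin 2) ℚ)) * ((↑) '' p.2 : Set (GL (Fin 2) ℚ))).prod := by
  induction l with
  | nil => simp [stackSet, termCode, termDen, ← Set.singleton_one]
  | cons p l ih =>
    have hcons : stackSet (fracVal ∘ commonDen)
        ((termCode (E, p :: l)).2.flatMap fun p => [.char (clearDen p.1), p.2]) =
          {fracVal (commonDen (clearDen (matCode p.1)))} *
          (ratSet ((p.2.map fun h : P2Q => matCode h).map (fracVal ∘ commonDen)) *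
          stackSet (fracVal ∘ commonDen)
            ((termCode (E, l)).2.flatMap fun p => [.char (clearDen p.1), p.2])) := by
      rw [← stackSet_cons]
      exact stackSet_cons _ _
    have hden : (termDen (termCode (E, p :: l)) : ℚ) =
        (commonDen (matCode p.1)).2 * termDen (termCode (E, l)) := by
      simp [termDen, termCode]
    rw [hcons, hden, ih, fracVal_commonDen_clearDen, ratSet_map_matCode, ← Set.smul_set_singleton,
      List.map_cons, List.map_cons, List.prod_cons, Set.image_mul, Set.image_mul,
      Set.image_singleton, mul_smul_comm, mul_smul_comm, smul_mul_assoc, smul_smul, mul_comm,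
      mul_assoc]
    rfl

theorem image_fracVal_stackSet_termStack :
    fracVal '' stackSet commonDen (termStack (termCode T)) = (termDen (termCode T) : ℚ) •
      Units.coeHom _ '' flatProduct P2Q (ratSet T.1) (T.2.map fun p => (p.1, ratSet p.2)) := by
  rw [image_stackSet, termStack, stackSet_cons, stackSet_flatMap_clearDen T.1 T.2, flatProduct,
    Set.image_mul, mul_smul_comm]
  congr 2
  exact ratSet_map_matCode T.1

theorem fracVal_termTarget (g : GL (Fin 2) ℚ) :
    fracVal (termTarget (matCode g) (termCode T)) = (termDen (termCode T) : ℚ) • g.1 := by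
  rw [← fracVal_commonDen_matCode g, fracVal_apply, fracVal_apply, termTarget, ratMat_smul,
    smul_comm, Int.cast_natCast]

theorem exists_unfolds_termStack_iff (g : GL (Fin 2) ℚ) :
    (∃ k, Unfolds commonDen (termStack (termCode T)) k [] ∧
        fracVal k = fracVal (termTarget (matCode g) (termCode T))) ↔
      g ∈ flatProduct P2Q (ratSet T.1) (T.2.map fun p => (p.1, ratSet p.2)) := by
  have hden : (termDen (termCode T) : ℚ) ≠ 0 := Nat.cast_ne_zero.2 (termDen_ne_zero T)
  simp only [← mem_stackSet_iff]
  rw [← Set.mem_image, image_fracVal_stackSet_termStack, fracVal_termTarget,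
    Set.smul_mem_smul_set_iff₀ hden]
  exact Units.val_injective.mem_set_image

end Descriptions

/-! ### The decision procedure -/

/-- After `n` moves from `s`, nothing is left over and the value `g` has been split off. -/
def HitAt (s : Stack MatCode) (g : FracMat) (n : ℕ) : Prop :=
  ∃ u ∈ reachAt commonDen s n, u.1 = [] ∧ FracEq u.2 g

/-- After `n` moves from `s`, the next letter can be one outside `P(2,ℚ)`. -/
def BadAt (s : Stack MatCode) (n : ℕ) : Prop :=
  ∃ u ∈ reachAt commonDen s n, ∃ p ∈ next commonDen u.1, ¬Admissible p.1

/-- The inputs of the decision procedure. Those which describe nothing are to be dealt with, too. -/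
abbrev Input : Type :=
  MatCode × FlatExpr MatCode MatCode

/-- A radius with lists of nodes and edges, intended for `Refutes`. -/
abbrev Certificate : Type :=
  ℕ × List Node × List Edge

/-- Membership is established by `n` moves. -/
def Accepts (i : Input) (n : ℕ) : Prop :=
  ∃ T ∈ i.2, HitAt (termStack T) (termTarget i.1 T) n

/-- The number `n` encodes a list of certificates which contains one against every term, or `n`
moves show that the input is malformed. -/
def Rejects (i : Input) (n : ℕ) : Prop :=
  ((commonDen i.1).2 = 0 ∨ ∃ T ∈ i.2, BadAt (termStack T) n) ∨
    ∀ T ∈ i.2, ∃ c ∈ (Encodable.decode (α := List Certificate) n).getD [],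
      Refutes (termStack T) (termTarget i.1 T) c.1 c.2.1 c.2.2

section PrimrecDecision

variable {α : Type*} [Primcodable α] {a : α → MatCode} {T : α → Term}

@[fun_prop]
theorem primrec_clearDen (ha : Primrec a) : Primrec fun c => clearDen (a c) := by
  have hentry (i j) : Primrec fun c => (commonDen (a c)).1 i j :=
    primrec_matrix_apply (Primrec.fst.comp (primrec_commonDen ha)) i j
  exact Primrec.pair (Primrec.pair (by fun_prop) (by fun_prop))
    (Primrec.pair (by fun_prop) (by fun_prop))

@[fun_prop]
theorem primrec_termStack (hT : Primrec T) : Primrec fun c => termStack (T c) := by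
  unfold termStack
  fun_prop

@[fun_prop]
theorem primrec_termDen (hT : Primrec T) : Primrec fun c => termDen (T c) := by
  have hmul : Primrec₂ fun (_ : List ℕ) (p : ℕ × ℕ) => p.1 * p.2 :=
    (by fun_prop : Primrec fun p : List ℕ × ℕ × ℕ => p.2.1 * p.2.2)
  have hprod : Primrec (List.prod (α := ℕ)) :=
    (Primrec.list_foldr Primrec.id (Primrec.const 1) hmul).of_eq fun _ => List.prod_eq_foldr.symm
  unfold termDen
  fun_prop

@[fun_prop]
theorem primrec_termTarget (ha : Primrec a) (hT : Primrec T) :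
    Primrec fun c => termTarget (a c) (T c) := by
  exact Primrec.pair (primrec_matrix_smul (by fun_prop) (Primrec.fst.comp (primrec_commonDen ha)))
    (by fun_prop)

variable {s : α → Stack MatCode} {g : α → FracMat} {n : α → ℕ}

@[fun_prop]
theorem primrecPred_hitAt (hs : Primrec s) (hg : Primrec g) (hn : Primrec n) :
    PrimrecPred fun c => HitAt (s c) (g c) (n c) := by
  unfold HitAt
  fun_prop

@[fun_prop]
theorem primrecPred_badAt (hs : Primrec s) (hn : Primrec n) :
    PrimrecPred fun c => BadAt (s c) (n c) := by
  unfold BadAt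
  fun_prop

@[fun_prop]
theorem primrecPred_exists_refutes {L : α → List Certificate} (hL : Primrec L) (hs : Primrec s)
    (hg : Primrec g) : PrimrecPred fun c => ∃ x ∈ L c, Refutes (s c) (g c) x.1 x.2.1 x.2.2 :=
  primrecPred_exists_mem hL (primrecPred_refutes (by fun_prop) (by fun_prop) (by fun_prop)
    (by fun_prop) (by fun_prop))

theorem primrecRel_accepts : PrimrecRel Accepts := by
  unfold Accepts PrimrecRel
  fun_prop

theorem primrecRel_rejects : PrimrecRel Rejects := by
  have hdecode : Primrec fun n : ℕ => (Encodable.decode (α := List Certificate) n).getD [] :=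
    Primrec.option_getD.comp Primrec.decode (Primrec.const [])
  have hrefutes : PrimrecPred fun x : Input × ℕ => ∀ T ∈ x.1.2,
      ∃ c ∈ (Encodable.decode (α := List Certificate) x.2).getD [],
        Refutes (termStack T) (termTarget x.1.1 T) c.1 c.2.1 c.2.2 :=
    primrecPred_forall_mem (by fun_prop)
      (primrecPred_exists_refutes (hdecode.comp (by fun_prop)) (by fun_prop) (by fun_prop))
  have hden : PrimrecPred fun x : Input × ℕ => (commonDen x.1.1).2 = 0 :=
    primrecPred_eq (Primrec.snd.comp (primrec_commonDen (by fun_prop))) (Primrec.const 0)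
  have hbad : PrimrecPred fun x : Input × ℕ => ∃ T ∈ x.1.2, BadAt (termStack T) x.2 := by
    fun_prop
  exact (hden.or hbad).or hrefutes

end PrimrecDecision

theorem isAdmissible_iff {s : Stack MatCode} : IsAdmissible s ↔ ∀ n, ¬BadAt s n := by
  constructor
  · rintro hs n ⟨u, hu, p, hp, hbad⟩
    exact hbad (hs u.2 u.1 (unfolds_iff_exists_mem_reachAt.2 ⟨n, hu⟩) p hp)
  · intro hs k t hk p hp
    obtain ⟨n, hn⟩ := unfolds_iff_exists_mem_reachAt.1 hk
    by_contra hbad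
    exact hs n ⟨_, hn, p, hp, hbad⟩

theorem exists_hitAt_iff {s : Stack MatCode} {g : FracMat} (hs : IsAdmissible s) (hg : g.2 ≠ 0) :
    (∃ n, HitAt s g n) ↔ ∃ k, Unfolds commonDen s k [] ∧ fracVal k = fracVal g := by
  constructor
  · rintro ⟨n, ⟨t, k⟩, hu, rfl, heq⟩
    have hk : Unfolds commonDen s k [] := unfolds_iff_exists_mem_reachAt.2 ⟨n, hu⟩
    exact ⟨k, hk, (fracEq_iff (hk.den_ne_zero hs) hg).1 heq⟩
  · rintro ⟨k, hk, hkg⟩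
    obtain ⟨n, hn⟩ := unfolds_iff_exists_mem_reachAt.1 hk
    exact ⟨n, _, hn, rfl, (fracEq_iff (hk.den_ne_zero hs) hg).2 hkg⟩

theorem exists_accepts_or_rejects (i : Input) : ∃ n, Accepts i n ∨ Rejects i n := by
  by_contra! h
  have hg : (commonDen i.1).2 ≠ 0 := fun h0 => (h 0).2 (.inl (.inl h0))
  have hadm (T) (hT : T ∈ i.2) : IsAdmissible (termStack T) :=
    isAdmissible_iff.2 fun n hn => (h n).2 (.inl (.inr ⟨T, hT, hn⟩))
  have hcert (T) (hT : T ∈ i.2) :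
      ∃ c : Certificate, Refutes (termStack T) (termTarget i.1 T) c.1 c.2.1 c.2.2 := by
    have hmiss (k) (hk : Unfolds commonDen (termStack T) k []) :
        fracVal k ≠ fracVal (termTarget i.1 T) := fun hkg => by
      obtain ⟨n, hn⟩ := (exists_hitAt_iff (g := termTarget i.1 T) (hadm T hT) hg).2 ⟨k, hk, hkg⟩
      exact (h n).1 ⟨T, hT, hn⟩
    obtain ⟨N, V, E, hE⟩ := exists_refutes (g := termTarget i.1 T) (hadm T hT) hg hmiss
    exact ⟨(N, V, E), hE⟩
  choose c hc using hcert
  refine (h (Encodable.encode (i.2.attach.map fun T => c T.1 T.2))).2 (.inr fun T hT => ?_)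
  rw [Encodable.encodek]
  exact ⟨c T hT, List.mem_map.2 ⟨⟨T, hT⟩, List.mem_attach _ _, rfl⟩, hc T hT⟩

section Correctness

variable {E : FlatExpr (GL (Fin 2) ℚ) P2Q} {g : GL (Fin 2) ℚ} {n : ℕ}

theorem mem_flatSet_iff : g ∈ flatSet P2Q E ↔ ∃ T ∈ E,
    ∃ k, Unfolds commonDen (termStack (termCode T)) k [] ∧
      fracVal k = fracVal (termTarget (matCode g) (termCode T)) := by
  simp only [flatSet, Set.mem_iUnion, exists_prop, exists_unfolds_termStack_iff]

theorem mem_flatSet_of_accepts (h : Accepts (matCode g, flatCode E) n) : g ∈ flatSet P2Q E := by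
  obtain ⟨_, hT, hn⟩ := h
  obtain ⟨T, hTE, rfl⟩ := List.mem_map.1 hT
  exact mem_flatSet_iff.2 ⟨T, hTE, (exists_hitAt_iff (g := termTarget (matCode g) (termCode T))
    (isAdmissible_termStack T) (commonDen_matCode_ne_zero g)).1 ⟨n, hn⟩⟩

theorem notMem_flatSet_of_rejects (h : Rejects (matCode g, flatCode E) n) :
    g ∉ flatSet P2Q E := by
  rw [mem_flatSet_iff]
  rintro ⟨T, hT, k, hk, hkg⟩
  rcases h with (h0 | ⟨_, hT', hbad⟩) | hcert
  · exact commonDen_matCode_ne_zero g h0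
  · obtain ⟨T', -, rfl⟩ := List.mem_map.1 hT'
    exact isAdmissible_iff.1 (isAdmissible_termStack T') n hbad
  · obtain ⟨c, -, hc⟩ := hcert (termCode T) (List.mem_map_of_mem hT)
    exact hc.fracVal_ne (isAdmissible_termStack T) (commonDen_matCode_ne_zero g) hk hkg

end Correctness

end FlatRat

/-- There is one algorithm such that, for every flat rational subset `R` of `GL(2,ℚ)` relative to
`P(2,ℚ)`: the set `R` is described by some flat rational expression, and, given the description of
any such expression for `R` and of any `g ∈ GL(2,ℚ)`, the algorithm decides whether `g ∈ R`. -/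
theorem mainTheorem3 :
    ∃ decider : FlatRat.MatCode × FlatRat.FlatExpr FlatRat.MatCode FlatRat.MatCode → Bool,
      Computable decider ∧
      ∀ R : Set (Matrix.GeneralLinearGroup (Fin 2) ℚ),
        FlatRat.IsFlatRational FlatRat.P2Q R →
          (∃ E : FlatRat.FlatExpr (Matrix.GeneralLinearGroup (Fin 2) ℚ) FlatRat.P2Q,
            FlatRat.flatSet FlatRat.P2Q E = R) ∧
          ∀ E : FlatRat.FlatExpr (Matrix.GeneralLinearGroup (Fin 2) ℚ) FlatRat.P2Q,
            FlatRat.flatSet FlatRat.P2Q E = R →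
            ∀ g : Matrix.GeneralLinearGroup (Fin 2) ℚ,
              decider (FlatRat.matCode g, FlatRat.flatCode E) = true ↔ g ∈ R := by
  obtain ⟨f, hf, hspec⟩ := FlatRat.exists_computable_search FlatRat.primrecRel_accepts
    FlatRat.primrecRel_rejects FlatRat.exists_accepts_or_rejects
  refine ⟨f, hf, fun R hR => ⟨hR.exists_flatSet, ?_⟩⟩
  rintro E rfl g
  obtain ⟨hyes, hno⟩ := hspec (FlatRat.matCode g, FlatRat.flatCode E)
  constructor
  · intro htrue
    obtain ⟨n, hn⟩ := hyes htrue
    exact FlatRat.mem_flatSet_of_accepts hn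
  · contrapose
    intro hfalse
    obtain ⟨n, hn⟩ := hno (Bool.eq_false_of_not_eq_true hfalse)
    exact FlatRat.notMem_flatSet_of_rejects hn
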